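/- **Conventions.** Entourages of a uniform space are taken symmetric. For an entourage $E$ of $X$, an *$E$-chain* from $x$ to $y$ is a finite sequence $x=x_1,\dots,x_n=y$, $n\ge 1$, with $(x_i,x_{i+1})\in E$; two $E$-chains from $x$ to $y$ are *$E$-homotopic rel. endpoints* if one is obtained from the other by finitely many additions and deletions of single points, through $E$-chains from $x$ to $y$ (equivalently, if the corresponding edge paths in the Rips complex of finite $E$-bounded subsets of $X$ are homotopic rel. endpoints). A *generalized path* $\alpha$ from $x$ to $y$ is a family $(\alpha_E)_E$, indexed by all entourages of $X$, of $E$-homotopy classes of $E$-chains from $x$ to $y$ such that $\alpha_F$ is $E$-homotopic to $\alpha_E$ whenever $F\subset E$. Generalized paths are concatenated and inverted termwise; $\alpha$ is *$E$-short* if $(x,y)\in E$ and $\alpha_E$ is the class of the chain $x,y$. The set $GP(X,x_0)$ of generalized paths starting at $x_0$ has the uniform structure with basis of entourages $E^*=\{(\alpha,\beta): \alpha^{-1}\beta \text{ is } E\text{-short}\}$, and the *uniform fundamental group* $\check\pi_1(X,x_0)\subset GP(X,x_0)$ is the group of generalized loops at $x_0$ under concatenation, with the subspace topology. A uniformly continuous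 $f:X\to Y$ induces $f_*:GP(X,x_0)\to GP(Y,f(x_0))$ by $(f_*\alpha)_E=[f(\alpha_{f^{-1}(E)})]$, and this restricts to a homomorphism $f_*:\check\pi_1(X,x_0)\to\check\pi_1(Y,f(x_0))$. A uniform space $X$ is *chain connected* if for every entourage $E$ any two points are joined by an $E$-chain, and *locally uniform joinable* if for every entourage $E$ there is an entourage $F\subset E$ such that any $(x,y)\in F$ are joined by an $E$-short generalized path. A map $f:Z\to X$ of uniform spaces is a *generalized uniform covering map* if 1. the images $f(E)$ of the entourages $E$ of $Z$ form a basis of the uniform structure of $X$; 2. (chain lifting) for each entourage $E$ of $Z$ there is an entourage $F$ of $Z$ such that for every $z\in Z$ any $f(F)$-chain starting at $f(z)$ lifts to an $E$-chain starting at $z$; 3. (approximate uniqueness of chain lifts) for each entourage $E$ of $Z$ there is an entourage $F\subset E$ such that any two $F$-chains $(x_i)$, $(y_i)$ in $Z$ with the same starting point and the same image under $f$ satisfy $(x_i,y_i)\in E$ for all $i$; 4. (generalized path lifting) for each $z\in Z$, every generalized path in $X$ starting at $f(z)$ is $f_*(\alpha)$ for some generalized path $\alpha$ in $Z$ starting at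 $z$. Two maps $f:Z\to X$ and $g:W\to X$ are *uniform equivalent* if $f=g\circ h$ for some uniform equivalence (bijection, uniformly continuous in both directions) $h:Z\to W$. **Theorem.** Let $X$ be a Hausdorff, locally uniform joinable and chain connected uniform space, and let $x_0\in X$. For every generalized uniform covering map $f:Z\to X$ with $Z$ Hausdorff, locally uniform joinable and chain connected, and every $z_0\in f^{-1}(x_0)$, the subgroup $f_*(\check\pi_1(Z,z_0))$ of $\check\pi_1(X,x_0)$ is closed, and the assignment $$f\longmapsto \text{conjugacy class of } f_*(\check\pi_1(Z,z_0))$$ is independent of the choice of $z_0$ and induces a bijection from the set of uniform equivalence classes of generalized uniform covering maps $f:Z\to X$ with $Z$ Hausdorff, locally uniform joinable and chain connected onto the set of conjugacy classes of closed subgroups of $\check\pi_1(X,x_0)$. -/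

import Mathlib

open scoped Uniformity Topology

universe u

namespace UnifCov

/-- An entourage of a uniform space; entourages are symmetric, so that inverses of
`E`-chains are `E`-chains. -/
structure Entourage (X : Type*) [UniformSpace X] where
  carrier : Set (X × X)
  mem_uniformity : carrier ∈ 𝓤 X
  symm : ∀ {x y : X}, (x, y) ∈ carrier → (y, x) ∈ carrier

namespace Entourage

variable {X Y : Type*} [UniformSpace X] [UniformSpace Y]

theorem refl (E : Entourage X) (x : X) : (x, x) ∈ E.carrier :=
  refl_mem_uniformity E.mem_uniformity

/-- The intersection of two entourages. -/
def inter (E F : Entourage X) : Entourage X where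
  carrier := E.carrier ∩ F.carrier
  mem_uniformity := Filter.inter_mem E.mem_uniformity F.mem_uniformity
  symm h := ⟨E.symm h.1, F.symm h.2⟩

/-- The entourage `f⁻¹(E)` of a uniformly continuous function `f`. -/
def preimage {f : X → Y} (hf : UniformContinuous f) (E : Entourage Y) : Entourage X where
  carrier := {p | (f p.1, f p.2) ∈ E.carrier}
  mem_uniformity := hf E.mem_uniformity
  symm h := E.symm h

/-- The image `f(E) = {(f x, f y) | (x, y) ∈ E}` of an entourage. -/
def image (f : X → Y) (E : Entourage X) : Set (Y × Y) :=
  (fun p : X × X => (f p.1, f p.2)) '' E.carrier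

end Entourage

/-! ### Chains and their homotopy classes -/

/-- A finite sequence of points is an `E`-chain if successive points form elements of `E`. -/
def IsEChain {X : Type*} (E : Set (X × X)) (l : List X) : Prop :=
  l.IsChain (fun a b => (a, b) ∈ E)

/-- An `E`-chain `x = x₁, …, xₙ = y` (with `n ≥ 1`). -/
@[ext]
structure EChain {X : Type*} (E : Set (X × X)) (x y : X) where
  pts : List X
  isChain : IsEChain E pts
  head_eq : pts.head? = some x
  last_eq : pts.getLast? = some y

namespace EChain

variable {X Y : Type*} {E F : Set (X × X)} {x y z : X}

/-- The constant chain `x`. -/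
def refl (E : Set (X × X)) (x : X) : EChain E x x :=
  ⟨[x], by simp [IsEChain], by simp, by simp⟩

/-- The chain `x, y`. -/
def edge (h : (x, y) ∈ E) : EChain E x y :=
  ⟨[x, y], by simpa [IsEChain] using h, by simp, by simp⟩

theorem exists_cons (c : EChain E x y) : ∃ t, c.pts = x :: t := by
  rcases c with ⟨_ | ⟨a, t⟩, h1, h2, h3⟩
  · simp at h2
  · exact ⟨t, by simpa using h2⟩

theorem exists_concat (c : EChain E x y) : ∃ t, c.pts = t ++ [y] := by
  rcases c with ⟨l, h1, h2, h3⟩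
  exact ⟨l.dropLast, (List.dropLast_append_getLast? y h3).symm⟩

/-- The concatenation `x₁, …, xₙ = y₁, y₂, …, yₘ`. -/
def trans (c : EChain E x y) (d : EChain E y z) : EChain E x z where
  pts := c.pts ++ d.pts.tail
  isChain := by
    obtain ⟨s, hs⟩ := c.exists_concat
    obtain ⟨t, ht⟩ := d.exists_cons
    have h1 := c.isChain
    have h2 := d.isChain
    rw [hs] at h1 ⊢
    rw [ht] at h2 ⊢
    have := List.IsChain.append_overlap (l₂ := [y]) h1 (l₃ := t) (by simpa [IsEChain] using h2) (by simp)
    simpa [IsEChain] using this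
  head_eq := by
    obtain ⟨s, hs⟩ := c.exists_cons
    simp [hs]
  last_eq := by
    obtain ⟨s, hs⟩ := c.exists_concat
    obtain ⟨t, ht⟩ := d.exists_cons
    have h := d.last_eq
    rw [ht] at h
    rw [hs, ht]
    rcases t with _ | ⟨a, t⟩
    · simpa using h
    · simp at h
      simp [h]

/-- The inverse chain `xₙ, …, x₁`. -/
def reverse (hE : ∀ {x y : X}, (x, y) ∈ E → (y, x) ∈ E) (c : EChain E x y) : EChain E y x where
  pts := c.pts.reverse
  isChain := by
    unfold IsEChain
    rw [List.isChain_reverse]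
    exact c.isChain.imp (fun _ _ h => hE h)
  head_eq := by rw [List.head?_reverse]; exact c.last_eq
  last_eq := by rw [List.getLast?_reverse]; exact c.head_eq

/-- The image of an `E`-chain under a function carrying `E` into `F`. -/
def map {F : Set (Y × Y)} (f : X → Y) (hf : ∀ p ∈ E, (f p.1, f p.2) ∈ F) {x' y' : Y}
    (hx : f x = x') (hy : f y = y') (c : EChain E x y) : EChain F x' y' where
  pts := c.pts.map f
  isChain := by
    unfold IsEChain
    rw [List.isChain_map]
    exact c.isChain.imp (fun a b h => hf (a, b) h)
  head_eq := by simp [c.head_eq, hx]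
  last_eq := by simp [c.last_eq, hy]

/-- The elementary step of an `E`-homotopy relative endpoints: `d` is obtained from `c` by adding
a single point, where both are `E`-chains from `x` to `y`. -/
def Step (c d : EChain E x y) : Prop :=
  ∃ (l₁ l₂ : List X) (b : X), c.pts = l₁ ++ l₂ ∧ d.pts = l₁ ++ b :: l₂

/-- Two `E`-chains from `x` to `y` are `E`-homotopic relative endpoints if one is obtained from the
other by finitely many additions and deletions of single points, through `E`-chains from `x` to
`y`. Equivalently, the edge paths they determine in the Rips complex are homotopic. -/
def Homotopic : EChain E x y → EChain E x y → Prop := Relation.EqvGen Step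

theorem Step.trans_right {c c' : EChain E x y} (h : Step c c') (d : EChain E y z) :
    Step (c.trans d) (c'.trans d) := by
  obtain ⟨l₁, l₂, b, h1, h2⟩ := h
  exact ⟨l₁, l₂ ++ d.pts.tail, b, by simp [trans, h1], by simp [trans, h2]⟩

theorem Step.trans_left (c : EChain E x y) {d d' : EChain E y z} (h : Step d d') :
    Step (c.trans d) (c.trans d') := by
  obtain ⟨l₁, l₂, b, h1, h2⟩ := h
  rcases l₁ with _ | ⟨a, l₁⟩
  · refine ⟨c.pts, l₂.tail, y, by simp [trans, h1], ?_⟩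
    obtain ⟨t, ht⟩ := d.exists_cons
    simp only [List.nil_append] at h1 h2
    rw [ht] at h1
    simp [trans, h2, ← h1]
  · exact ⟨c.pts ++ l₁, l₂, b, by simp [trans, h1], by simp [trans, h2]⟩

theorem Step.reverse (hE : ∀ {x y : X}, (x, y) ∈ E → (y, x) ∈ E) {c d : EChain E x y}
    (h : Step c d) : Step (c.reverse hE) (d.reverse hE) := by
  obtain ⟨l₁, l₂, b, h1, h2⟩ := h
  exact ⟨l₂.reverse, l₁.reverse, b, by simp [EChain.reverse, h1], by simp [EChain.reverse, h2]⟩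

theorem Step.map {F : Set (Y × Y)} {f : X → Y} {hf : ∀ p ∈ E, (f p.1, f p.2) ∈ F} {x' y' : Y}
    {hx : f x = x'} {hy : f y = y'} {c d : EChain E x y} (h : Step c d) :
    Step (c.map f hf hx hy) (d.map f hf hx hy) := by
  obtain ⟨l₁, l₂, b, h1, h2⟩ := h
  exact ⟨l₁.map f, l₂.map f, f b, by simp [EChain.map, h1], by simp [EChain.map, h2]⟩

end EChain

/-- The `E`-homotopy classes relative endpoints of `E`-chains from `x` to `y`. -/
def ChainClass {X : Type*} (E : Set (X × X)) (x y : X) : Type _ :=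
  Quot (EChain.Homotopic (E := E) (x := x) (y := y))

namespace ChainClass

variable {X Y : Type*} {E : Set (X × X)} {x y z w : X}

/-- The class of a chain. -/
def mk (c : EChain E x y) : ChainClass E x y := Quot.mk _ c

theorem sound_step {c d : EChain E x y} (h : c.Step d) : mk c = mk d :=
  Quot.sound (Relation.EqvGen.rel _ _ h)

theorem sound_homotopic {α : Sort*} (g : EChain E x y → α)
    (hg : ∀ c d, c.Step d → g c = g d) (c d : EChain E x y) (h : c.Homotopic d) : g c = g d := by
  induction h with
  | rel _ _ h => exact hg _ _ h
  | refl _ => rfl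
  | symm _ _ _ ih => exact ih.symm
  | trans _ _ _ _ _ ih1 ih2 => exact ih1.trans ih2

theorem ind {p : ChainClass E x y → Prop} (h : ∀ c, p (mk c)) (a : ChainClass E x y) : p a :=
  Quot.ind h a

/-- Concatenation of homotopy classes of chains. -/
def trans (a : ChainClass E x y) (b : ChainClass E y z) : ChainClass E x z :=
  Quot.lift
    (fun c => Quot.lift (fun d => mk (c.trans d))
      (sound_homotopic _ fun _ _ h => sound_step (h.trans_left c)) b)
    (sound_homotopic _ fun _ _ h => by
      induction b using ind with | _ d
      exact sound_step (h.trans_right d)) a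

/-- Inverses of homotopy classes of chains. -/
def reverse (hE : ∀ {x y : X}, (x, y) ∈ E → (y, x) ∈ E) (a : ChainClass E x y) :
    ChainClass E y x :=
  Quot.lift (fun c => mk (c.reverse hE))
    (sound_homotopic _ fun _ _ h => sound_step (h.reverse hE)) a

/-- The image of a homotopy class of chains. -/
def map {F : Set (Y × Y)} (f : X → Y) (hf : ∀ p ∈ E, (f p.1, f p.2) ∈ F) {x' y' : Y}
    (hx : f x = x') (hy : f y = y') (a : ChainClass E x y) : ChainClass F x' y' :=
  Quot.lift (fun c => mk (c.map f hf hx hy))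
    (sound_homotopic _ fun _ _ h => sound_step h.map) a

/-- The `F`-homotopy class of an `E`-homotopy class of `E`-chains, where `E ⊆ F`. -/
def ofSubset {F : Set (X × X)} (h : E ⊆ F) (a : ChainClass E x y) : ChainClass F x y :=
  map id (fun _ hp => h hp) rfl rfl a

theorem trans_mk (c : EChain E x y) (d : EChain E y z) : (mk c).trans (mk d) = mk (c.trans d) :=
  rfl

theorem trans_assoc (a : ChainClass E x y) (b : ChainClass E y z) (c : ChainClass E z w) :
    (a.trans b).trans c = a.trans (b.trans c) := by
  induction a using ind with | _ a
  induction b using ind with | _ b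
  induction c using ind with | _ c
  simp only [trans_mk]
  congr 1
  obtain ⟨t, ht⟩ := b.exists_cons
  ext1
  simp [EChain.trans, ht]

theorem refl_trans (a : ChainClass E x y) : (mk (EChain.refl E x)).trans a = a := by
  induction a using ind with | _ a
  rw [trans_mk]
  congr 1
  obtain ⟨t, ht⟩ := a.exists_cons
  ext1
  simp [EChain.trans, EChain.refl, ht]

theorem trans_refl (a : ChainClass E x y) : a.trans (mk (EChain.refl E y)) = a := by
  induction a using ind with | _ a
  rw [trans_mk]
  congr 1
  ext1
  simp [EChain.trans, EChain.refl]

theorem reverse_reverse (hE : ∀ {x y : X}, (x, y) ∈ E → (y, x) ∈ E) (a : ChainClass E x y) :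
    (a.reverse hE).reverse hE = a := by
  induction a using ind with | _ a
  change mk _ = mk _
  congr 1
  ext1
  simp [EChain.reverse]

theorem reverse_trans (hE : ∀ {x y : X}, (x, y) ∈ E → (y, x) ∈ E) (a : ChainClass E x y)
    (b : ChainClass E y z) : (a.trans b).reverse hE = (b.reverse hE).trans (a.reverse hE) := by
  induction a using ind with | _ a
  induction b using ind with | _ b
  change mk _ = mk _
  congr 1
  obtain ⟨s, hs⟩ := a.exists_concat
  obtain ⟨t, ht⟩ := b.exists_cons
  ext1
  simp [EChain.reverse, EChain.trans, hs, ht]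

theorem reverse_edge (hE : ∀ {x y : X}, (x, y) ∈ E → (y, x) ∈ E) (h : (x, y) ∈ E) :
    (mk (EChain.edge h)).reverse hE = mk (EChain.edge (hE h)) := rfl

theorem edge_self (h : (x, x) ∈ E) : mk (EChain.edge h) = mk (EChain.refl E x) :=
  (sound_step ⟨[x], [], x, rfl, rfl⟩).symm

theorem edge_trans_edge (h : (x, y) ∈ E) (h' : (y, z) ∈ E) (h'' : (x, z) ∈ E) :
    (mk (EChain.edge h)).trans (mk (EChain.edge h')) = mk (EChain.edge h'') :=
  (sound_step ⟨[x], [z], y, rfl, rfl⟩).symm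

theorem reverse_trans_self (hE : ∀ {x y : X}, (x, y) ∈ E → (y, x) ∈ E)
    (hr : ∀ x : X, (x, x) ∈ E) (a : ChainClass E x y) :
    (a.reverse hE).trans a = mk (EChain.refl E y) := by
  induction a using ind with | _ a
  obtain ⟨l, h1, h2, h3⟩ := a
  induction l generalizing x with
  | nil => simp at h2
  | cons a t ih =>
    obtain rfl : a = x := by simpa using h2
    rcases t with _ | ⟨b, t⟩
    · obtain rfl : a = y := by simpa using h3
      rfl
    · have hab : (a, b) ∈ E := (List.isChain_cons_cons.1 h1).1
      have hch : IsEChain E (b :: t) := (List.isChain_cons_cons.1 h1).2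
      have hl : (b :: t).getLast? = some y := by simpa [List.getLast?_cons_cons] using h3
      have key : (mk ⟨a :: b :: t, h1, h2, h3⟩ : ChainClass E a y) =
          (mk (EChain.edge hab)).trans (mk ⟨b :: t, hch, rfl, hl⟩) := rfl
      rw [key, reverse_trans, trans_assoc, ← trans_assoc _ (mk (EChain.edge hab)),
        reverse_edge, edge_trans_edge _ _ (hr b), edge_self, refl_trans]
      exact ih hch rfl hl

end ChainClass

/-! ### Generalized paths -/

section

variable {X Y : Type*} [UniformSpace X] [UniformSpace Y] {x y z : X}

/-- A generalized path from `x` to `y`: a family of `E`-homotopy classes `α_E` of `E`-chains from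
`x` to `y`, indexed by all entourages `E`, such that `α_F` is `E`-homotopic to `α_E` whenever
`F ⊆ E`. -/
@[ext]
structure GenPath (x y : X) where
  term : ∀ E : Entourage X, ChainClass E.carrier x y
  compat : ∀ (E F : Entourage X) (h : F.carrier ⊆ E.carrier),
    (term F).ofSubset h = term E

namespace GenPath

/-- The constant generalized path. -/
def refl (x : X) : GenPath x x where
  term E := ChainClass.mk (EChain.refl E.carrier x)
  compat _ _ _ := rfl

/-- Concatenation of generalized paths. -/
def trans (α : GenPath x y) (β : GenPath y z) : GenPath x z where
  term E := (α.term E).trans (β.term E)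
  compat E F h := by
    rw [← α.compat E F h, ← β.compat E F h]
    generalize α.term F = a
    generalize β.term F = b
    induction a using ChainClass.ind with | _ a
    induction b using ChainClass.ind with | _ b
    change ChainClass.mk _ = ChainClass.mk _
    congr 1
    ext1
    simp [EChain.map, EChain.trans]

/-- The inverse of a generalized path. -/
def reverse (α : GenPath x y) : GenPath y x where
  term E := (α.term E).reverse E.symm
  compat E F h := by
    rw [← α.compat E F h]
    generalize α.term F = a
    induction a using ChainClass.ind with | _ a
    change ChainClass.mk _ = ChainClass.mk _
    congr 1
    ext1
    simp [EChain.map, EChain.reverse]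

/-- The generalized path induced by a uniformly continuous function `f`, whose `E`-term is the
image of the `f⁻¹(E)`-term. -/
def map {f : X → Y} (hf : UniformContinuous f) {x' y' : Y} (hx : f x = x') (hy : f y = y')
    (α : GenPath x y) : GenPath x' y' where
  term E := (α.term (E.preimage hf)).map f (fun _ hp => hp) hx hy
  compat E F h := by
    rw [← α.compat (E.preimage hf) (F.preimage hf) (fun _ hp => h hp)]
    generalize α.term _ = a
    induction a using ChainClass.ind with | _ a
    change ChainClass.mk _ = ChainClass.mk _
    congr 1
    ext1
    simp [EChain.map]

/-- A generalized path from `x` to `y` is `E`-short if its `E`-term is the class of the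
`E`-chain `x, y`. -/
def IsShort (E : Entourage X) (α : GenPath x y) : Prop :=
  ∃ h : (x, y) ∈ E.carrier, α.term E = ChainClass.mk (EChain.edge h)

end GenPath

/-- The set `GP(X, x₀)` of generalized paths in `X` starting at `x₀`. -/
def GP (X : Type*) [UniformSpace X] (x₀ : X) : Type _ := Σ y : X, GenPath x₀ y

namespace GP

variable {x₀ : X}

/-- The set `E*` of the pairs `(α, β)` such that `α⁻¹β` is `E`-short. -/
def star (x₀ : X) (E : Entourage X) : Set (GP X x₀ × GP X x₀) :=
  {p | (p.1.2.reverse.trans p.2.2).IsShort E}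

/-- The uniform structure on `GP(X, x₀)` for which the sets `E*` form a basis of entourages. -/
instance : UniformSpace (GP X x₀) :=
  UniformSpace.ofCore <| UniformSpace.Core.mkOfBasis
    { sets := Set.range (star x₀)
      nonempty := ⟨_, ⟨⟨Set.univ, Filter.univ_mem, fun _ => trivial⟩, rfl⟩⟩
      inter_sets := by
        rintro _ _ ⟨E, rfl⟩ ⟨F, rfl⟩
        refine ⟨_, ⟨E.inter F, rfl⟩, ?_⟩
        rintro ⟨α, β⟩ ⟨h, e⟩
        refine ⟨⟨h.1, ?_⟩, ⟨h.2, ?_⟩⟩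
        · rw [← GenPath.compat _ E (E.inter F) Set.inter_subset_left, e]; rfl
        · rw [← GenPath.compat _ F (E.inter F) Set.inter_subset_right, e]; rfl }
    (by
      rintro _ ⟨E, rfl⟩ α
      refine ⟨E.refl _, ?_⟩
      rw [ChainClass.edge_self]
      exact ChainClass.reverse_trans_self E.symm E.refl _)
    (by
      rintro _ ⟨E, rfl⟩
      refine ⟨_, ⟨E, rfl⟩, ?_⟩
      rintro ⟨α, β⟩ ⟨h, e⟩
      refine ⟨E.symm h, ?_⟩
      rw [← ChainClass.reverse_edge E.symm h, ← e]
      change _ = ((ChainClass.reverse E.symm _).trans _).reverse E.symm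
      rw [ChainClass.reverse_trans, ChainClass.reverse_reverse]
      rfl)
    (by
      rintro _ ⟨E, rfl⟩
      obtain ⟨V, hV, hs, hc⟩ := comp_symm_mem_uniformity_sets E.mem_uniformity
      let F : Entourage X := ⟨V, hV, fun h => hs.symm _ _ h⟩
      have hFE : F.carrier ⊆ E.carrier := fun p hp =>
        hc ⟨p.1, F.refl p.1, hp⟩
      refine ⟨_, ⟨F, rfl⟩, ?_⟩
      rintro ⟨α, γ⟩ ⟨β, ⟨h1, e1⟩, ⟨h2, e2⟩⟩
      have h3 : (α.1, γ.1) ∈ E.carrier := hc ⟨β.1, h1, h2⟩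
      refine ⟨h3, ?_⟩
      have e1' : (ChainClass.reverse E.symm (α.2.term E)).trans (β.2.term E)
          = ChainClass.mk (EChain.edge (hFE h1)) := by
        have := GenPath.compat (α.2.reverse.trans β.2) E F hFE
        rw [e1] at this
        exact this.symm
      have e2' : (ChainClass.reverse E.symm (β.2.term E)).trans (γ.2.term E)
          = ChainClass.mk (EChain.edge (hFE h2)) := by
        have := GenPath.compat (β.2.reverse.trans γ.2) E F hFE
        rw [e2] at this
        exact this.symm
      have hβ : (β.2.term E).trans (ChainClass.reverse E.symm (β.2.term E))
          = ChainClass.mk (EChain.refl _ _) := by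
        have := ChainClass.reverse_trans_self E.symm E.refl
          (ChainClass.reverse E.symm (β.2.term E))
        rwa [ChainClass.reverse_reverse] at this
      change (ChainClass.reverse E.symm (α.2.term E)).trans (γ.2.term E) = _
      rw [← ChainClass.edge_trans_edge (hFE h1) (hFE h2) h3, ← e1', ← e2',
        ChainClass.trans_assoc, ← ChainClass.trans_assoc (β.2.term E), hβ,
        ChainClass.refl_trans])

/-- The induced function `f_* : GP(X, x₀) → GP(Y, f(x₀))`. -/
def map {f : X → Y} (hf : UniformContinuous f) (x₀ : X) (α : GP X x₀) : GP Y (f x₀) :=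
  ⟨f α.1, α.2.map hf rfl rfl⟩

end GP

/-- The uniform fundamental group `π̌₁(X, x₀)`: generalized loops at `x₀`. -/
def UnifPi1 (X : Type*) [UniformSpace X] (x₀ : X) : Type _ := GenPath x₀ x₀

namespace UnifPi1

variable {x₀ : X}

/-- The group structure, given by concatenation. -/
instance : Group (UnifPi1 X x₀) where
  mul α β := GenPath.trans α β
  one := GenPath.refl x₀
  inv α := GenPath.reverse α
  mul_assoc α β γ := GenPath.ext (funext fun _ => ChainClass.trans_assoc _ _ _)
  one_mul α := GenPath.ext (funext fun _ => ChainClass.refl_trans _)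
  mul_one α := GenPath.ext (funext fun _ => ChainClass.trans_refl _)
  inv_mul_cancel α :=
    GenPath.ext (funext fun E => ChainClass.reverse_trans_self E.symm E.refl _)

/-- The uniform structure (and topology) as a subspace of `GP(X, x₀)`. -/
instance : UniformSpace (UnifPi1 X x₀) :=
  UniformSpace.comap (fun α => (⟨x₀, α⟩ : GP X x₀)) (inferInstanceAs (UniformSpace (GP X x₀)))

/-- The homomorphism `f_* : π̌₁(X, x₀) → π̌₁(Y, y₀)` where `f(x₀) = y₀`. -/
def map {f : X → Y} (hf : UniformContinuous f) {x₀ : X} {y₀ : Y} (h : f x₀ = y₀) :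
    UnifPi1 X x₀ →* UnifPi1 Y y₀ where
  toFun α := GenPath.map hf h h α
  map_one' := GenPath.ext (funext fun E => by
    change ChainClass.mk _ = ChainClass.mk _
    congr 1
    ext1
    simp [EChain.map, EChain.refl, h])
  map_mul' α β := GenPath.ext (funext fun E => by
    change ((GenPath.term α (E.preimage hf)).trans (GenPath.term β (E.preimage hf))).map f
        (fun _ hp => hp) h h =
      ((GenPath.term α (E.preimage hf)).map f (fun _ hp => hp) h h).trans
        ((GenPath.term β (E.preimage hf)).map f (fun _ hp => hp) h h)
    generalize GenPath.term α _ = a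
    generalize GenPath.term β _ = b
    induction a using ChainClass.ind with | _ a
    induction b using ChainClass.ind with | _ b
    change ChainClass.mk _ = ChainClass.mk _
    congr 1
    ext1
    simp [EChain.map, EChain.trans])

end UnifPi1

end

/-! ### Properties of spaces and maps -/

section

variable {X Y : Type*} [UniformSpace X] [UniformSpace Y]

/-- Any two points are joined by an `E`-chain, for each entourage `E`. -/
def ChainConnected (X : Type*) [UniformSpace X] : Prop :=
  ∀ (E : Entourage X) (x y : X), Nonempty (EChain E.carrier x y)

/-- For each entourage `E` there is an entourage `F ⊆ E` such that any `(x, y) ∈ F` are joined by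
an `E`-short generalized path. -/
def LocallyUniformJoinable (X : Type*) [UniformSpace X] : Prop :=
  ∀ E : Entourage X, ∃ F : Entourage X, F.carrier ⊆ E.carrier ∧
    ∀ x y : X, (x, y) ∈ F.carrier → ∃ α : GenPath x y, α.IsShort E

/-- `f` generates the uniform structure of `Y`: the images of the entourages of `X` form a basis
of the uniform structure of `Y`. -/
def GeneratesUniformity (f : X → Y) : Prop :=
  (𝓤 Y).HasBasis (fun _ : Entourage X => True) (fun E => E.image f)

theorem GeneratesUniformity.uniformContinuous {f : X → Y} (h : GeneratesUniformity f) :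
    UniformContinuous f := by
  intro V hV
  obtain ⟨E, -, hE⟩ := h.mem_iff.1 hV
  exact Filter.mem_map.2 (Filter.mem_of_superset E.mem_uniformity
    fun p hp => hE (Set.mem_image_of_mem (fun q : X × X => (f q.1, f q.2)) hp))

/-- Chain lifting: for each entourage `E` of `X` there is an entourage `F` of `X` such that any
`f(F)`-chain starting at `f(x)` lifts to an `E`-chain starting at `x`. -/
def ChainLifting (f : X → Y) : Prop :=
  ∀ E : Entourage X, ∃ F : Entourage X, ∀ (x : X) (l : List Y),
    IsEChain (F.image f) (f x :: l) →
      ∃ l' : List X, IsEChain E.carrier (x :: l') ∧ l'.map f = l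

/-- Approximate uniqueness of chain lifts: for each entourage `E` there is an entourage `F ⊆ E`
such that any two `F`-chains that start at the same point and have identical images are
`E`-close. -/
def ApproxUniqueChainLifts (f : X → Y) : Prop :=
  ∀ E : Entourage X, ∃ F : Entourage X, F.carrier ⊆ E.carrier ∧
    ∀ (x : X) (l l' : List X), IsEChain F.carrier (x :: l) → IsEChain F.carrier (x :: l') →
      l.map f = l'.map f → List.Forall₂ (fun a b => (a, b) ∈ E.carrier) l l'

/-- Generalized path lifting: any generalized path starting at `f(x)` lifts to a generalized path
starting at `x`. -/
def GenPathLifting {f : X → Y} (hf : UniformContinuous f) : Prop :=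
  ∀ (x : X) (β : GP Y (f x)), ∃ α : GP X x, GP.map hf x α = β

/-- Generalized uniform covering maps. -/
structure IsGenUniformCovering (f : X → Y) : Prop where
  generates : GeneratesUniformity f
  chainLifting : ChainLifting f
  approxUnique : ApproxUniqueChainLifts f
  genPathLifting : GenPathLifting generates.uniformContinuous

end

/-! ### The two sides of the classification -/

/-- A generalized uniform covering map over `X` whose covering space is Hausdorff, locally uniform
joinable and chain connected. -/
structure GenCovering (X : Type u) [UniformSpace X] where
  space : Type u
  [uniformSpace : UniformSpace space]
  [t2 : T2Space space]
  locallyUniformJoinable : LocallyUniformJoinable space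
  chainConnected : ChainConnected space
  proj : space → X
  isCovering : IsGenUniformCovering proj

attribute [instance] GenCovering.uniformSpace GenCovering.t2

namespace GenCovering

variable {X : Type u} [UniformSpace X]

/-- Uniform equivalence of maps `f` and `g`: a uniform equivalence `h` with `f = g ∘ h`. -/
instance equivalence (X : Type u) [UniformSpace X] : Setoid (GenCovering X) where
  r p q := ∃ h : p.space ≃ᵤ q.space, p.proj = q.proj ∘ h
  iseqv :=
    { refl := fun p => ⟨UniformEquiv.refl _, rfl⟩
      symm := by
        rintro p q ⟨h, e⟩
        exact ⟨h.symm, by ext z; simp [e]⟩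
      trans := by
        rintro p q r ⟨h, e⟩ ⟨k, e'⟩
        exact ⟨h.trans k, by ext z; simp [e, e']⟩ }

/-- The image `p_*(π̌₁(Z, z₀))` in `π̌₁(X, x₀)`, where `p(z₀) = x₀`. -/
def imagePi1 (p : GenCovering X) {z₀ : p.space} {x₀ : X} (h : p.proj z₀ = x₀) :
    Subgroup (UnifPi1 X x₀) :=
  (UnifPi1.map p.isCovering.generates.uniformContinuous h).range

end GenCovering

/-- The closed subgroups of `π̌₁(X, x₀)`. -/
def ClosedSubgroup (X : Type*) [UniformSpace X] (x₀ : X) : Type _ :=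
  {H : Subgroup (UnifPi1 X x₀) // IsClosed (H : Set (UnifPi1 X x₀))}

/-- Conjugacy of closed subgroups: `K = g H g⁻¹` for some `g`. -/
instance ClosedSubgroup.conjugacy (X : Type*) [UniformSpace X] (x₀ : X) :
    Setoid (ClosedSubgroup X x₀) where
  r H K := ∃ g : UnifPi1 X x₀, K.1 = H.1.map (MulAut.conj g).toMonoidHom
  iseqv :=
    { refl := fun H => ⟨1, by ext; simp⟩
      symm := by
        rintro H K ⟨g, e⟩
        refine ⟨g⁻¹, ?_⟩
        rw [e, Subgroup.map_map]
        ext; simp [mul_assoc]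
      trans := by
        rintro H K L ⟨g, e⟩ ⟨g', e'⟩
        refine ⟨g' * g, ?_⟩
        rw [e', e, Subgroup.map_map]
        ext; simp }

end UnifCov

/-! The classical correspondence between coverings and subgroups survives once exact lifting is
replaced by lifting at every scale. The central fact is `exists_homotopy_lifting`: sufficiently
short chains in $Z$ from a common start whose images are homotopic are themselves homotopic, up to
one short edge between their endpoints. A homotopy may have arbitrarily many steps, so the errors of
its steps cannot simply be added. However, all the errors lie in one fibre, and approximate
uniqueness compares a chain inside a fibre with a constant chain, which bounds the total drift
independently of its length (`exists_fibre_chain_close`).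

It follows that a generalized path with short image is short (`exists_isShort_of_isShort_map`). When
$Z$ is Hausdorff, the endpoint of a lift is then determined by the path below
(`endpoint_eq_of_map_eq`). This gives closedness of $f_*(\check\pi_1(Z,z_0))$, conjugation under
change of base point, and the lifting criterion `exists_map_of_imagePi1_le`. Joinability of the
source makes the lifted map uniformly continuous. Two coverings with the same image therefore map to
each other by mutually inverse maps, which is injectivity.

For surjectivity, a closed subgroup $H$ acts on $GP(X,x_0)$ by left translation, and the covering is
the orbit space with the endpoint projection. Right concatenation commutes with this action, so
short generalized paths in $X$ give short edges upstairs, and chains lift edge by edge. Closedness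
of $H$ makes the quotient Hausdorff. A loop $\beta$ lifts to a path from the orbit of the constant
path to the orbit of $\beta$, so it lifts to a loop exactly when $\beta\in H$. -/

namespace UnifCov

/-! ### Entourages -/

namespace Entourage

variable {X Y : Type*} [UniformSpace X]

/-- A symmetric member of the uniformity inside a given one. -/
theorem exists_subset {V : Set (X × X)} (hV : V ∈ 𝓤 X) : ∃ E : Entourage X, E.carrier ⊆ V := by
  obtain ⟨W, hW, hs, hc⟩ := symm_of_uniformity hV
  exact ⟨⟨W, hW, fun h => hs.symm _ _ h⟩, hc⟩

theorem exists_comp (E : Entourage X) : ∃ F : Entourage X, F.carrier ⊆ E.carrier ∧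
    ∀ x y z : X, (x, y) ∈ F.carrier → (y, z) ∈ F.carrier → (x, z) ∈ E.carrier := by
  obtain ⟨V, hV, hs, hc⟩ := comp_symm_mem_uniformity_sets E.mem_uniformity
  exact ⟨⟨V, hV, fun h => hs.symm _ _ h⟩,
    fun p hp => hc ⟨p.1, refl_mem_uniformity hV, hp⟩, fun x y z h h' => hc ⟨y, h, h'⟩⟩

theorem mem_image {f : X → Y} (E : Entourage X) {x y : X} (h : (x, y) ∈ E.carrier) :
    (f x, f y) ∈ E.image f := ⟨(x, y), h, rfl⟩

theorem image_mono (f : X → Y) {E F : Entourage X} (h : E.carrier ⊆ F.carrier) :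
    E.image f ⊆ F.image f := Set.image_mono h

/-- Points of a Hausdorff uniform space that are `E`-close for all `E` agree. -/
theorem eq_of_forall_mem [T2Space X] {x y : X} (h : ∀ E : Entourage X, (x, y) ∈ E.carrier) :
    x = y := by
  refine eq_of_forall_symmetric fun {V} hV _ => ?_
  obtain ⟨E, hE⟩ := exists_subset hV
  exact hE (h E)

/-- The image of an entourage under a map generating the uniform structure. -/
def imageOf [UniformSpace Y] {f : X → Y} (hf : GeneratesUniformity f) (E : Entourage X) :
    Entourage Y where
  carrier := E.image f
  mem_uniformity := hf.mem_of_mem trivial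
  symm := by
    rintro x y ⟨⟨a, b⟩, h, e⟩
    obtain ⟨rfl, rfl⟩ := Prod.mk.inj e
    exact E.mem_image (E.symm h)

end Entourage

/-! ### Chains -/

namespace EChain

variable {X Y : Type*} {E F : Set (X × X)} {x y z : X}

/-- An `E`-chain regarded as an `F`-chain, where `E ⊆ F`. -/
def weaken (h : E ⊆ F) (c : EChain E x y) : EChain F x y :=
  ⟨c.pts, c.isChain.imp fun _ _ hp => h hp, c.head_eq, c.last_eq⟩

theorem ofList_last {x : X} {l : List X} (h : IsEChain E (x :: l)) :
    ∃ (y : X) (c : EChain E x y), c.pts = x :: l :=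
  ⟨(x :: l).getLast (by simp), ⟨x :: l, h, rfl, List.getLast?_eq_getLast_of_ne_nil _⟩, rfl⟩

/-- In an elementary step the new point may be taken to follow the starting point. -/
theorem Step.exists_cons {c d : EChain E x y} (h : c.Step d) :
    ∃ s b t, c.pts = x :: (s ++ t) ∧ d.pts = x :: (s ++ b :: t) := by
  obtain ⟨l₁, l₂, b, h1, h2⟩ := h
  obtain ⟨u, hu⟩ := c.exists_cons
  obtain ⟨v, hv⟩ := d.exists_cons
  rcases l₁ with _ | ⟨a, l₁⟩
  · simp only [List.nil_append] at h1 h2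
    rw [hv] at h2
    rw [hu] at h1
    obtain ⟨rfl, rfl⟩ := List.cons.inj h2
    exact ⟨[], x, u, by simpa using hu, by simp [hv, ← h1]⟩
  · rw [hu] at h1
    obtain ⟨rfl, -⟩ := List.cons.inj h1
    exact ⟨l₁, b, l₂, by simp [hu, h1], by simp [h2]⟩

theorem homotopic_equivalence (E : Set (X × X)) (x y : X) :
    Equivalence (Homotopic (E := E) (x := x) (y := y)) :=
  Relation.EqvGen.is_equivalence _

end EChain

namespace ChainClass

variable {X Y : Type*} {E F : Set (X × X)} {x y z : X}

theorem exact {c d : EChain E x y} (h : mk c = mk d) : c.Homotopic d :=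
  (EChain.homotopic_equivalence E x y).eqvGen_iff.1 (Quot.eqvGen_exact h)

theorem ofSubset_mk (h : E ⊆ F) (c : EChain E x y) : (mk c).ofSubset h = mk (c.weaken h) := by
  change mk _ = mk _
  congr 1
  ext1
  simp [EChain.map, EChain.weaken]

theorem mk_cons {a : X} {l : List X} (h : IsEChain E (x :: a :: l))
    (hl : (x :: a :: l).getLast? = some y) :
    (mk ⟨x :: a :: l, h, rfl, hl⟩ : ChainClass E x y) =
      (mk (EChain.edge (List.isChain_cons_cons.1 h).1)).trans
        (mk ⟨a :: l, (List.isChain_cons_cons.1 h).2, rfl,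
          by simpa [List.getLast?_cons_cons] using hl⟩) := rfl

/-- Induction over the edges of a chain, starting with the first. -/
theorem edge_induction {p : ∀ x : X, ChainClass E x y → Prop}
    (refl : p y (mk (EChain.refl E y)))
    (edge : ∀ (x z : X) (h : (x, z) ∈ E) (a : ChainClass E z y), p z a →
      p x ((mk (EChain.edge h)).trans a)) (x : X) (a : ChainClass E x y) : p x a := by
  induction a using ind with | _ a
  obtain ⟨l, h1, h2, h3⟩ := a
  induction l generalizing x with
  | nil => simp at h2
  | cons b t ih =>
    obtain rfl : b = x := by simpa using h2
    rcases t with _ | ⟨c, t⟩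
    · obtain rfl : b = y := by simpa using h3
      exact refl
    · rw [mk_cons]
      exact edge _ _ _ _ (ih _ _ _ _)

theorem map_trans {F : Set (Y × Y)} (f : X → Y) (hf : ∀ p ∈ E, (f p.1, f p.2) ∈ F)
    {x' y' z' : Y} (hx : f x = x') (hy : f y = y') (hz : f z = z') (a : ChainClass E x y)
    (b : ChainClass E y z) :
    (a.trans b).map f hf hx hz = (a.map f hf hx hy).trans (b.map f hf hy hz) := by
  induction a using ind with | _ a
  induction b using ind with | _ b
  change mk _ = mk _
  congr 1
  ext1
  simp [EChain.map, EChain.trans]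

theorem map_reverse {F : Set (Y × Y)} (f : X → Y) (hf : ∀ p ∈ E, (f p.1, f p.2) ∈ F)
    (hE : ∀ {x y : X}, (x, y) ∈ E → (y, x) ∈ E) (hF : ∀ {x y : Y}, (x, y) ∈ F → (y, x) ∈ F)
    {x' y' : Y} (hx : f x = x') (hy : f y = y') (a : ChainClass E x y) :
    (a.reverse hE).map f hf hy hx = (a.map f hf hx hy).reverse hF := by
  induction a using ind with | _ a
  change mk _ = mk _
  congr 1
  ext1
  simp [EChain.map, EChain.reverse]

theorem map_map {Z : Type*} {F : Set (Y × Y)} {G : Set (Z × Z)} (f : X → Y) (g : Y → Z)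
    (hf : ∀ p ∈ E, (f p.1, f p.2) ∈ F) (hg : ∀ p ∈ F, (g p.1, g p.2) ∈ G)
    {x' y' : Y} {x'' y'' : Z} (hx : f x = x') (hy : f y = y') (hx' : g x' = x'')
    (hy' : g y' = y'') (h : ∀ p ∈ E, (g (f p.1), g (f p.2)) ∈ G) (hxx : (g ∘ f) x = x'')
    (hyy : (g ∘ f) y = y'') (a : ChainClass E x y) :
    (a.map f hf hx hy).map g hg hx' hy' = a.map (g ∘ f) h hxx hyy := by
  induction a using ind with | _ a
  change mk _ = mk _
  congr 1
  ext1
  simp [EChain.map]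

theorem ofSubset_trans (h : E ⊆ F) (a : ChainClass E x y) (b : ChainClass E y z) :
    (a.trans b).ofSubset h = (a.ofSubset h).trans (b.ofSubset h) :=
  map_trans _ _ _ _ _ _ _

theorem ofSubset_ofSubset {G : Set (X × X)} (h : E ⊆ F) (h' : F ⊆ G) (a : ChainClass E x y) :
    (a.ofSubset h).ofSubset h' = a.ofSubset (h.trans h') :=
  map_map _ _ _ _ _ _ _ _ _ _ _ _

theorem trans_edge_self (a : ChainClass E x y) (h : (y, y) ∈ E) :
    a.trans (mk (EChain.edge h)) = a := by rw [edge_self, trans_refl]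

end ChainClass

/-! ### Lifting homotopies of chains -/

section HomotopyLifting

variable {X Y : Type*}

open ChainClass

/-- Pointwise close chains are homotopic up to the edges joining their endpoints. -/
theorem edge_trans_eq_of_forall₂ {E F : Set (X × X)} (hFE : F ⊆ E)
    (hF : ∀ x y z, (x, y) ∈ F → (y, z) ∈ F → (x, z) ∈ E) {l l' : List X}
    (hl : List.Forall₂ (fun a b => (a, b) ∈ F) l l') {x x' y y' : X} (hx : (x, x') ∈ F)
    (c : EChain F x y) (c' : EChain F x' y') (hc : c.pts = x :: l) (hc' : c'.pts = x' :: l') :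
    ∃ hy : (y, y') ∈ F,
      (mk (EChain.edge (hFE hx))).trans (mk (c'.weaken hFE)) =
        (mk (c.weaken hFE)).trans (mk (EChain.edge (hFE hy))) := by
  induction hl generalizing x x' with
  | nil =>
    obtain ⟨p, h1, h2, h3⟩ := c
    obtain ⟨p', h1', h2', h3'⟩ := c'
    simp only at hc hc'
    subst hc hc'
    obtain rfl : x = y := by simpa using h3
    obtain rfl : x' = y' := by simpa using h3'
    refine ⟨hx, ?_⟩
    exact (trans_refl _).trans (refl_trans _).symm
  | @cons a a' l l' ha _ ih =>
    obtain ⟨p, h1, h2, h3⟩ := c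
    obtain ⟨p', h1', h2', h3'⟩ := c'
    simp only at hc hc'
    subst hc hc'
    have e1 : (x, a) ∈ F := (List.isChain_cons_cons.1 h1).1
    have e1' : (x', a') ∈ F := (List.isChain_cons_cons.1 h1').1
    let d : EChain F a y := ⟨a :: l, (List.isChain_cons_cons.1 h1).2, rfl,
      by simpa [List.getLast?_cons_cons] using h3⟩
    let d' : EChain F a' y' := ⟨a' :: l', (List.isChain_cons_cons.1 h1').2, rfl,
      by simpa [List.getLast?_cons_cons] using h3'⟩
    obtain ⟨hy, e⟩ := ih ha d d' rfl rfl
    refine ⟨hy, ?_⟩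
    change (mk (EChain.edge (hFE hx))).trans ((mk (EChain.edge (hFE e1'))).trans
      (mk (d'.weaken hFE))) = ((mk (EChain.edge (hFE e1))).trans (mk (d.weaken hFE))).trans _
    -- The square $x, x', a', a$ has the diagonal $(x,a')\in E$; both sides reduce to this diagonal
    -- followed by `d'`.
    rw [trans_assoc, ← e, ← trans_assoc, ← trans_assoc,
      edge_trans_edge _ _ (hF _ _ _ hx e1'), edge_trans_edge _ _ (hF _ _ _ e1 ha)]

variable [UniformSpace X]

/-- Approximately unique lifts of the same chain are homotopic up to a short edge. -/
theorem trans_edge_eq_of_same_image {f : X → Y} {E₁ E₂ E : Entourage X}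
    (h21 : E₂.carrier ⊆ E₁.carrier) (h1 : E₁.carrier ⊆ E.carrier)
    (hcomp : ∀ x y z, (x, y) ∈ E₁.carrier → (y, z) ∈ E₁.carrier → (x, z) ∈ E.carrier)
    (hu : ∀ (x : X) (l l' : List X), IsEChain E₂.carrier (x :: l) → IsEChain E₂.carrier (x :: l') →
      l.map f = l'.map f → List.Forall₂ (fun a b => (a, b) ∈ E₁.carrier) l l')
    {z w w' : X} (c : EChain E₂.carrier z w) (c' : EChain E₂.carrier z w')
    (hcc : c.pts.map f = c'.pts.map f) :
    f w = f w' ∧ ∃ h : (w, w') ∈ E₁.carrier,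
      (mk (c.weaken (h21.trans h1))).trans (mk (EChain.edge (h1 h))) =
        mk (c'.weaken (h21.trans h1)) := by
  obtain ⟨l, hl⟩ := c.exists_cons
  obtain ⟨l', hl'⟩ := c'.exists_cons
  have hf : f w = f w' := by
    have := congrArg List.getLast? hcc
    simpa [List.getLast?_map, c.last_eq, c'.last_eq] using this
  have hF := hu z l l' (hl ▸ c.isChain) (hl' ▸ c'.isChain)
    (by rw [hl, hl'] at hcc; exact (List.cons.inj hcc).2)
  obtain ⟨h, e⟩ := edge_trans_eq_of_forall₂ h1 hcomp hF (E₁.refl z) (c.weaken h21)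
    (c'.weaken h21) hl hl'
  refine ⟨hf, h, ?_⟩
  rw [edge_self, refl_trans] at e
  exact e.symm

/-- Deleting a point of the lift of a chain. -/
theorem exists_lift_delete {f : X → Y} {E₂ E₃ E : Entourage X}
    (h32 : E₃.carrier ⊆ E₂.carrier) (h2 : E₂.carrier ⊆ E.carrier)
    (hcomp : ∀ x y z, (x, y) ∈ E₃.carrier → (y, z) ∈ E₃.carrier → (x, z) ∈ E₂.carrier)
    {z w : X} {v : Y} (c : EChain E₃.carrier z w) {x b : Y} {s t : List Y}
    (hc : c.pts.map f = x :: (s ++ b :: t)) (hv : (x :: (s ++ t)).getLast? = some v)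
    (hv' : f w = v) :
    ∃ (w' : X) (c' : EChain E₂.carrier z w'), c'.pts.map f = x :: (s ++ t) ∧ f w' = f w ∧
      ∃ h : (w', w) ∈ E₃.carrier,
        (mk (c'.weaken h2)).trans (mk (EChain.edge (h2 (h32 h)))) =
          mk (c.weaken (h32.trans h2)) := by
  obtain ⟨p, h1, hh, hl⟩ := c
  simp only at hc
  obtain ⟨x', p, rfl, rfl, hc'⟩ := List.map_eq_cons_iff.1 hc
  obtain ⟨s', p, rfl, rfl, hc''⟩ := List.map_eq_append_iff.1 hc'
  obtain ⟨b', t', rfl, rfl, rfl⟩ := List.map_eq_cons_iff.1 hc''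
  obtain rfl : x' = z := by simpa using hh
  -- If the deleted point is the last one, the shorter lift ends at its predecessor, which has the
  -- same image because the chain below keeps its endpoint. Otherwise the endpoint stays and the gap
  -- is bridged by an edge in `E₂`.
  rcases t' with _ | ⟨a, t'⟩
  · obtain rfl : b' = w := by
      have : (x' :: (s' ++ [b'])).getLast? = some b' := by
        rw [← List.cons_append, List.getLast?_append]; simp
      rw [this] at hl; simpa using hl
    have h1' : IsEChain E₃.carrier ((x' :: s') ++ [b']) := h1
    obtain ⟨h3, -, h4⟩ := List.isChain_append.1 h1'
    obtain ⟨w', hw'⟩ : ∃ w', (x' :: s').getLast? = some w' :=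
      ⟨_, List.getLast?_eq_getLast_of_ne_nil (by simp)⟩
    have hww : (w', b') ∈ E₃.carrier := h4 w' hw' b' rfl
    refine ⟨w', ⟨x' :: s', List.IsChain.imp (fun _ _ h => h32 h) h3, rfl, hw'⟩, by simp, ?_, hww, ?_⟩
    · rw [hv']
      have : ((x' :: s').map f).getLast? = some v := by simpa using hv
      rw [List.getLast?_map, hw'] at this
      simpa using this
    · change mk _ = mk _
      congr 1
  · have h1' : IsEChain E₃.carrier ((x' :: s') ++ b' :: a :: t') := h1
    obtain ⟨h3, h5, h4⟩ := List.isChain_append.1 h1'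
    obtain ⟨h5, h6⟩ := List.isChain_cons_cons.1 h5
    refine ⟨w, ⟨x' :: (s' ++ a :: t'), ?_, rfl, ?_⟩, by simp, rfl, E₃.refl w, ?_⟩
    · rw [← List.cons_append]
      refine List.isChain_append.2 ⟨List.IsChain.imp (fun _ _ h => h32 h) h3,
        List.IsChain.imp (fun _ _ h => h32 h) h6, ?_⟩
      intro u hu u' hu'
      obtain rfl : a = u' := by simpa using hu'
      exact hcomp _ _ _ (h4 u hu b' rfl) h5
    · rw [← hl, ← List.cons_append, ← List.cons_append]
      simp only [List.getLast?_append, List.getLast?_cons_cons]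
    · rw [trans_edge_self]
      exact sound_step ⟨x' :: s', a :: t', b', by simp [EChain.weaken], by simp [EChain.weaken]⟩

/-- Points joined by a short enough chain in a fibre are close. -/
theorem exists_fibre_chain_close {f : X → Y} (hf : ApproxUniqueChainLifts f) (E : Entourage X) :
    ∃ F : Entourage X, F.carrier ⊆ E.carrier ∧ ∀ w w' : X,
      Relation.ReflTransGen (fun a b => (a, b) ∈ F.carrier ∧ f a = f b) w w' →
        (w, w') ∈ E.carrier := by
  obtain ⟨F, hFE, hF⟩ := hf E
  refine ⟨F, hFE, fun w w' h => ?_⟩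
  obtain ⟨l, hl, hw'⟩ := List.exists_isChain_cons_of_relationReflTransGen h
  have hconst : ∀ a ∈ l, f a = f w := by
    clear hw' h
    induction l generalizing w with
    | nil => simp
    | cons a l ih =>
      obtain ⟨h1, h2⟩ := List.isChain_cons_cons.1 hl
      intro b hb
      rcases List.mem_cons.1 hb with rfl | hb
      · exact h1.2.symm
      · exact (ih a h2 b hb).trans h1.2.symm
  have h1 : IsEChain F.carrier (w :: l) := hl.imp fun _ _ h => h.1
  -- The constant chain at `w` has the same image as `l`, so approximate uniqueness keeps every
  -- point of `l` close to `w`, whatever the length.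
  have h2 : IsEChain F.carrier (w :: List.replicate l.length w) := by
    rw [← List.replicate_succ]
    exact List.isChain_replicate_of_rel _ (F.refl w)
  have h3 := hF w _ l h2 h1 (by
    rw [List.map_replicate]
    symm
    rw [List.eq_replicate_iff]
    exact ⟨by simp, by simpa using hconst⟩)
  have h4 : ∀ a ∈ w :: l, (w, a) ∈ E.carrier := by
    intro a ha
    rcases List.mem_cons.1 ha with rfl | ha
    · exact E.refl _
    · obtain ⟨i, hi, rfl⟩ := List.mem_iff_getElem.1 ha
      have := List.Forall₂.get h3 (i := i) (by simpa using hi) hi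
      simpa using this
  exact hw' ▸ h4 _ (List.getLast_mem _)

/-- Homotopies of chains lift: short chains with homotopic images are homotopic up to a short edge
joining their endpoints. -/
theorem exists_homotopy_lifting {f : X → Y} (hu : ApproxUniqueChainLifts f) (hL : ChainLifting f)
    (E : Entourage X) :
    ∃ (F : Entourage X) (hFE : F.carrier ⊆ E.carrier), ∀ {z w w' : X} {y : Y}
      (c : EChain F.carrier z w) (c' : EChain F.carrier z w') (hw : f w = y) (hw' : f w' = y),
      (mk (c.map (F := F.image f) f (fun _ hp => F.mem_image hp) rfl hw) : ChainClass _ (f z) y) =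
        mk (c'.map f (fun _ hp => F.mem_image hp) rfl hw') →
      ∃ h : (w, w') ∈ E.carrier,
        (mk (c.weaken hFE)).trans (mk (EChain.edge h)) = mk (c'.weaken hFE) := by
  obtain ⟨G, hGE, hG⟩ := exists_fibre_chain_close hu E
  obtain ⟨K, hKE, hK⟩ := E.exists_comp
  obtain ⟨E₂, h21, hE₂⟩ := hu (G.inter K)
  obtain ⟨E₃, h32, hE₃⟩ := E₂.exists_comp
  obtain ⟨F, hF⟩ := hL E₃
  have h1 : (G.inter K).carrier ⊆ E.carrier := fun p hp => hGE hp.1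
  have h2 : E₂.carrier ⊆ E.carrier := h21.trans h1
  have h3 : E₃.carrier ⊆ E.carrier := h32.trans h2
  have hcomp : ∀ x y z, (x, y) ∈ (G.inter K).carrier → (y, z) ∈ (G.inter K).carrier →
      (x, z) ∈ E.carrier := fun x y z h h' => hK x y z h.2 h'.2
  -- The induction carries `R` rather than closeness: `R` is transitive, and `hG` turns it back into
  -- `E`-closeness after any number of steps.
  let R : X → X → Prop := Relation.ReflTransGen (fun a b => (a, b) ∈ G.carrier ∧ f a = f b)
  have : Std.Symm (fun a b => (a, b) ∈ G.carrier ∧ f a = f b) :=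
    ⟨fun a b h => ⟨G.symm h.1, h.2.symm⟩⟩
  have hRs : ∀ {a b}, R a b → R b a := fun {a b} h => Relation.ReflTransGen.stdSymm.symm _ _ h
  have key : ∀ {z : X} {y : Y} {d d' : EChain (F.image f) (f z) y}, d.Homotopic d' →
      ∀ {w w' : X} (c : EChain E₃.carrier z w) (c' : EChain E₃.carrier z w'),
        c.pts.map f = d.pts → c'.pts.map f = d'.pts →
        R w w' ∧ ∃ h : (w, w') ∈ E.carrier,
          (mk (c.weaken h3)).trans (mk (EChain.edge h)) = mk (c'.weaken h3) := by
    intro z y d d' hd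
    induction hd with
    | rel d d' hd =>
      intro w w' c c' hc hc'
      obtain ⟨s, b, t, hs, ht⟩ := hd.exists_cons
      have hw' : f w' = y := by
        have := congrArg List.getLast? hc'
        simpa [List.getLast?_map, c'.last_eq, d'.last_eq] using this
      -- Deleting the added point from the lift of `d'` gives a second lift of `d`, which
      -- approximate uniqueness compares with `c`.
      obtain ⟨v, c'', h4, h5, h6, h7⟩ := exists_lift_delete h32 h2 hE₃ c' (hc'.trans ht)
        (hs ▸ d.last_eq) hw'
      obtain ⟨h8, h9, h10⟩ := trans_edge_eq_of_same_image h21 h1 hcomp hE₂ (c.weaken h32) c''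
        (((hc.trans hs).trans h4.symm : _))
      have hR : R w w' := Relation.ReflTransGen.tail (Relation.ReflTransGen.single ⟨h9.1, h8⟩)
        ⟨(h21 (h32 h6)).1, h5⟩
      refine ⟨hR, hG _ _ hR, ?_⟩
      rw [← h7, ← h10, trans_assoc, edge_trans_edge]
      rfl
    | refl d =>
      intro w w' c c' hc hc'
      obtain ⟨h8, h9, h10⟩ := trans_edge_eq_of_same_image h21 h1 hcomp hE₂ (c.weaken h32)
        (c'.weaken h32) ((hc.trans hc'.symm : _))
      exact ⟨Relation.ReflTransGen.single ⟨h9.1, h8⟩, h1 h9, h10⟩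
    | symm d d' _ ih =>
      intro w w' c c' hc hc'
      obtain ⟨hR, h, e⟩ := ih c' c hc' hc
      refine ⟨hRs hR, E.symm h, ?_⟩
      rw [← e, trans_assoc, edge_trans_edge _ _ (E.refl _), trans_edge_self]
    | trans d d' d'' _ _ ih ih' =>
      intro w w' c c' hc hc'
      -- The intermediate chain comes without a lift; chain lifting supplies one from `z` on the
      -- scale `E₃`.
      obtain ⟨l, hl⟩ := d'.exists_cons
      obtain ⟨l', hl', e'⟩ := hF z l (hl ▸ d'.isChain)
      obtain ⟨v, e, he⟩ := EChain.ofList_last hl'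
      have he' : e.pts.map f = d'.pts := by simp [he, hl, e']
      obtain ⟨hR, h, e1⟩ := ih c e hc he'
      obtain ⟨hR', h', e2⟩ := ih' e c' he' hc'
      have hR'' : R w w' := hR.trans hR'
      refine ⟨hR'', hG _ _ hR'', ?_⟩
      rw [← e2, ← e1, trans_assoc, edge_trans_edge]
  refine ⟨F.inter E₃, fun p hp => h3 hp.2, fun {z w w' y} c c' hw hw' h => ?_⟩
  have hF' : (F.inter E₃).image f ⊆ F.image f := Entourage.image_mono f Set.inter_subset_left
  have h' := congrArg (fun a => ChainClass.ofSubset hF' a) h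
  simp only [ofSubset_mk] at h'
  exact (key (exact h') (c.weaken Set.inter_subset_right) (c'.weaken Set.inter_subset_right)
    rfl rfl).2

end HomotopyLifting

/-! ### The groupoid of generalized paths -/

namespace GenPath

variable {X Y Z : Type*} [UniformSpace X] [UniformSpace Y] [UniformSpace Z] {x y z w : X}

theorem trans_assoc (α : GenPath x y) (β : GenPath y z) (γ : GenPath z w) :
    (α.trans β).trans γ = α.trans (β.trans γ) :=
  GenPath.ext (funext fun _ => ChainClass.trans_assoc _ _ _)

theorem refl_trans (α : GenPath x y) : (refl x).trans α = α :=
  GenPath.ext (funext fun _ => ChainClass.refl_trans _)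

theorem trans_refl (α : GenPath x y) : α.trans (refl y) = α :=
  GenPath.ext (funext fun _ => ChainClass.trans_refl _)

theorem reverse_reverse (α : GenPath x y) : α.reverse.reverse = α :=
  GenPath.ext (funext fun E => ChainClass.reverse_reverse E.symm _)

theorem reverse_trans (α : GenPath x y) (β : GenPath y z) :
    (α.trans β).reverse = β.reverse.trans α.reverse :=
  GenPath.ext (funext fun E => ChainClass.reverse_trans E.symm _ _)

theorem reverse_trans_self (α : GenPath x y) : α.reverse.trans α = refl y :=
  GenPath.ext (funext fun E => ChainClass.reverse_trans_self E.symm E.refl _)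

theorem trans_reverse_self (α : GenPath x y) : α.trans α.reverse = refl x := by
  simpa only [reverse_reverse] using reverse_trans_self α.reverse

theorem reverse_trans_cancel (α : GenPath x y) (β : GenPath y z) :
    α.reverse.trans (α.trans β) = β := by
  rw [← trans_assoc, reverse_trans_self, refl_trans]

theorem trans_reverse_cancel (α : GenPath x y) (β : GenPath x z) :
    α.trans (α.reverse.trans β) = β := by
  rw [← trans_assoc, trans_reverse_self, refl_trans]

theorem map_trans {f : X → Y} (hf : UniformContinuous f) {x' y' z' : Y} (hx : f x = x')
    (hy : f y = y') (hz : f z = z') (α : GenPath x y) (β : GenPath y z) :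
    (α.trans β).map hf hx hz = (α.map hf hx hy).trans (β.map hf hy hz) :=
  GenPath.ext (funext fun _ => ChainClass.map_trans _ _ _ _ _ _ _)

theorem map_reverse {f : X → Y} (hf : UniformContinuous f) {x' y' : Y} (hx : f x = x')
    (hy : f y = y') (α : GenPath x y) :
    α.reverse.map hf hy hx = (α.map hf hx hy).reverse :=
  GenPath.ext (funext fun E => ChainClass.map_reverse _ _ (E.preimage hf).symm E.symm _ _ _)

/-- The composite is a separate map `k` with an equation, so that the lemma applies to projections
that are only propositionally composites. -/
theorem map_comp {f : X → Y} {g : Y → Z} {k : X → Z} (hf : UniformContinuous f)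
    (hg : UniformContinuous g) (hk : UniformContinuous k) (e : k = g ∘ f)
    {x' y' : Y} (hx : f x = x') (hy : f y = y') {x'' y'' : Z} (hx' : g x' = x'')
    (hy' : g y' = y'') (hxk : k x = x'') (hyk : k y = y'') (α : GenPath x y) :
    (α.map hf hx hy).map hg hx' hy' = α.map hk hxk hyk := by
  subst e
  exact GenPath.ext (funext fun _ => ChainClass.map_map _ _ _ _ _ _ _ _ _ _ _ _)

/-! ### Short generalized paths -/

theorem isShort_refl (E : Entourage X) (x : X) : (refl x).IsShort E :=
  ⟨E.refl x, (ChainClass.edge_self _).symm⟩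

theorem IsShort.mono {E F : Entourage X} (h : F.carrier ⊆ E.carrier) {α : GenPath x y}
    (hα : α.IsShort F) : α.IsShort E := by
  obtain ⟨h1, h2⟩ := hα
  exact ⟨h h1, by rw [← α.compat E F h, h2]; rfl⟩

theorem IsShort.reverse {E : Entourage X} {α : GenPath x y} (hα : α.IsShort E) :
    α.reverse.IsShort E := by
  obtain ⟨h1, h2⟩ := hα
  exact ⟨E.symm h1, by rw [← ChainClass.reverse_edge E.symm h1, ← h2]; rfl⟩

/-- Two edges of a triangle with all sides in $E$ collapse to the third. No smaller entourage is
needed, so the step can be iterated without loss of scale. -/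
theorem IsShort.trans_of_mem {E : Entourage X} {α : GenPath x y} {β : GenPath y z}
    (hα : α.IsShort E) (hβ : β.IsShort E) (h : (x, z) ∈ E.carrier) : (α.trans β).IsShort E := by
  obtain ⟨h1, h2⟩ := hα
  obtain ⟨h3, h4⟩ := hβ
  exact ⟨h, by rw [← ChainClass.edge_trans_edge h1 h3 h, ← h2, ← h4]; rfl⟩

theorem IsShort.trans {E F : Entourage X} (hFE : F.carrier ⊆ E.carrier)
    (hF : ∀ x y z, (x, y) ∈ F.carrier → (y, z) ∈ F.carrier → (x, z) ∈ E.carrier)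
    {α : GenPath x y} {β : GenPath y z} (hα : α.IsShort F) (hβ : β.IsShort F) :
    (α.trans β).IsShort E :=
  (hα.mono hFE).trans_of_mem (hβ.mono hFE) (hF _ _ _ hα.1 hβ.1)

theorem IsShort.map {f : X → Y} (hf : UniformContinuous f) {E : Entourage Y} {α : GenPath x y}
    (hα : α.IsShort (E.preimage hf)) {x' y' : Y} (hx : f x = x') (hy : f y = y') :
    (α.map hf hx hy).IsShort E := by
  subst hx hy
  obtain ⟨h1, h2⟩ := hα
  exact ⟨h1, by simp only [GenPath.map, h2]; rfl⟩

/-- In a Hausdorff space, the endpoints of a generalized path with short terms agree. -/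
theorem eq_of_forall_isShort [T2Space X] {α : GenPath x y} (h : ∀ E, α.IsShort E) : x = y :=
  Entourage.eq_of_forall_mem fun E => (h E).1

end GenPath

/-- In a chain connected, locally uniform joinable space any two points are joined by a
generalized path. -/
theorem LocallyUniformJoinable.nonempty_genPath {X : Type*} [UniformSpace X]
    (hX : LocallyUniformJoinable X) (hc : ChainConnected X) (x y : X) :
    Nonempty (GenPath x y) := by
  obtain ⟨F, -, hF⟩ := hX ⟨Set.univ, Filter.univ_mem, fun _ => trivial⟩
  obtain ⟨c⟩ := hc F x y
  refine ChainClass.edge_induction (p := fun x _ => Nonempty (GenPath x y)) ⟨GenPath.refl y⟩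
    ?_ x (ChainClass.mk c)
  rintro x z h a ⟨β⟩
  obtain ⟨α, -⟩ := hF x z h
  exact ⟨α.trans β⟩

/-! ### Lifts of generalized paths -/

section

variable {X Z : Type*} [UniformSpace X] [UniformSpace Z] {f : Z → X}

open ChainClass

/-- Generalized paths with sufficiently short image are short. -/
theorem exists_isShort_of_isShort_map (hg : GeneratesUniformity f)
    (hu : ApproxUniqueChainLifts f) (hL : ChainLifting f) (E : Entourage Z) :
    ∃ F : Entourage X, ∀ {y z : Z} {y' z' : X} (hy : f y = y') (hz : f z = z') (γ : GenPath y z),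
      (γ.map hg.uniformContinuous hy hz).IsShort F → γ.IsShort E := by
  obtain ⟨E', hE', hcomp⟩ := E.exists_comp
  obtain ⟨F, hFE, hF⟩ := exists_homotopy_lifting hu hL E'
  obtain ⟨K, hK⟩ := hL F
  refine ⟨(K.inter F).imageOf hg, ?_⟩
  rintro y z _ _ rfl rfl γ ⟨h1, h2⟩
  have hKF : (K.inter F).image f ⊆ F.image f := Entourage.image_mono f Set.inter_subset_right
  have hKK : (K.inter F).image f ⊆ K.image f := Entourage.image_mono f Set.inter_subset_left
  obtain ⟨c, hc⟩ : ∃ c, γ.term (K.inter F) = mk c := by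
    induction γ.term (K.inter F) using ChainClass.ind with | _ c => exact ⟨c, rfl⟩
  have h3 : (K.inter F).carrier ⊆
      (((K.inter F).imageOf hg).preimage hg.uniformContinuous).carrier :=
    fun p hp => Entourage.mem_image _ hp
  simp only [GenPath.map] at h2
  rw [← γ.compat _ _ h3, hc] at h2
  -- The edge from `f y` to `f z` lifts to an edge from `y` to some `z'` in the fibre of `z`.
  -- Homotopy lifting compares it with the chain `c`, so `z` is close to `z'` and hence to `y`.
  obtain ⟨l, hl, hl'⟩ := hK y [f z] (by simpa [IsEChain] using hKK h1)
  obtain ⟨z', rfl, hz'⟩ := List.map_eq_singleton_iff.1 hl'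
  have hyz : (y, z') ∈ F.carrier := by simpa [IsEChain] using hl
  have h4 := congrArg (fun a => a.ofSubset hKF) h2
  obtain ⟨h5, h6⟩ := hF (c.weaken Set.inter_subset_right) (EChain.edge hyz) rfl hz' (by
    refine Eq.trans (Eq.trans ?_ h4) ?_
    · change mk _ = mk _
      congr 1
      ext1
      simp [EChain.map, EChain.weaken]
    · change mk _ = mk _
      congr 1
      ext1
      simp [EChain.map, EChain.edge, hz'])
  have h7 : (y, z) ∈ E.carrier := hcomp _ _ _ (hFE hyz) (E'.symm h5)
  refine ⟨h7, ?_⟩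
  have hKE : (K.inter F).carrier ⊆ E.carrier := fun p hp => hE' (hFE hp.2)
  have h8 : (z, z') ∈ E.carrier := hE' h5
  have h9 : (y, z') ∈ E.carrier := hE' (hFE hyz)
  have h10 : (mk (c.weaken hKE)).trans (mk (EChain.edge h8)) = mk (EChain.edge h9) := by
    have := congrArg (fun a => a.ofSubset hE') h6
    simp only [ofSubset_trans, ofSubset_mk] at this
    exact this
  rw [← γ.compat E (K.inter F) hKE, hc, ofSubset_mk, ← edge_trans_edge h9 (E.symm h8) h7, ← h10,
    ChainClass.trans_assoc, edge_trans_edge _ _ (E.refl z), trans_edge_self]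

/-- A generalized path lifts as soon as all its terms are represented by images of chains with
fixed endpoints. -/
theorem exists_genPath_lift (hg : GeneratesUniformity f)
    (hu : ApproxUniqueChainLifts f) (hL : ChainLifting f) {z w : Z} (β : GenPath (f z) (f w))
    (h : ∀ E : Entourage Z, ∃ c : ChainClass E.carrier z w,
      c.map f (fun _ hp => E.mem_image hp) rfl rfl = β.term (E.imageOf hg)) :
    ∃ α : GenPath z w, α.map hg.uniformContinuous rfl rfl = β := by
  have h' : ∀ E : Entourage Z, ∃ c : EChain E.carrier z w,
      (mk c).map f (fun _ hp => E.mem_image hp) rfl rfl = β.term (E.imageOf hg) := by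
    intro E
    obtain ⟨a, ha⟩ := h E
    induction a using ChainClass.ind with | _ c => exact ⟨c, ha⟩
  choose c hc using h'
  choose F hFE hF using exists_homotopy_lifting hu hL
  -- The chosen chains need not be coherent, but one fine enough for homotopy lifting agrees at
  -- scale `E` with every finer one. All end at `w`, so the correcting edge is trivial. The lift
  -- uses the chain chosen for `F E` as its term at `E`.
  have key : ∀ E G : Entourage Z, ∀ hG : G.carrier ⊆ (F E).carrier,
      mk ((c (F E)).weaken (hFE E)) = mk ((c G).weaken (hG.trans (hFE E))) := by
    intro E G hG
    have hi : G.image f ⊆ (F E).image f := Entourage.image_mono f hG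
    obtain ⟨h1, h2⟩ := hF E (c (F E)) ((c G).weaken hG) rfl rfl (by
      refine (hc (F E)).trans ?_
      rw [← β.compat ((F E).imageOf hg) (G.imageOf hg) hi, ← hc G]
      change mk _ = mk _
      congr 1
      ext1
      simp [EChain.map, EChain.weaken])
    rw [trans_edge_self] at h2
    exact h2
  refine ⟨⟨fun E => mk ((c (F E)).weaken (hFE E)), fun E E' h => ?_⟩, ?_⟩
  · rw [key E ((F E).inter (F E')) Set.inter_subset_left,
      key E' ((F E).inter (F E')) Set.inter_subset_right, ofSubset_mk]
    rfl
  · refine GenPath.ext (funext fun E => ?_)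
    have hE : (F (E.preimage hg.uniformContinuous)).image f ⊆ E.carrier := by
      rintro _ ⟨p, hp, rfl⟩
      exact hFE (E.preimage hg.uniformContinuous) hp
    rw [← β.compat E ((F (E.preimage hg.uniformContinuous)).imageOf hg) hE, ← hc]
    change mk _ = mk _
    congr 1
    ext1
    simp [EChain.map, EChain.weaken]

/-- Lifts of the same generalized path starting at the same point have the same endpoint. -/
theorem endpoint_eq_of_map_eq [T2Space Z] (hg : GeneratesUniformity f)
    (hu : ApproxUniqueChainLifts f) (hL : ChainLifting f) {z₀ z z' : Z} {x₀ x : X}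
    (h₀ : f z₀ = x₀) (hz : f z = x) (hz' : f z' = x) {α : GenPath z₀ z} {β : GenPath z₀ z'}
    (h : α.map hg.uniformContinuous h₀ hz = β.map hg.uniformContinuous h₀ hz') : z = z' := by
  -- The image of $\alpha^{-1}\beta$ is constant, hence short at every scale.
  refine GenPath.eq_of_forall_isShort (α := α.reverse.trans β) fun E => ?_
  obtain ⟨F, hF⟩ := exists_isShort_of_isShort_map hg hu hL E
  refine hF hz hz' _ ?_
  rw [GenPath.map_trans _ hz h₀ hz', GenPath.map_reverse, ← h, GenPath.reverse_trans_self]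
  exact GenPath.isShort_refl F x

/-- Generalized path lifting for a path starting at a point equal to `f w₀`. -/
theorem GenPathLifting.exists_lift {hf : UniformContinuous f} (h : GenPathLifting hf) {w₀ : Z}
    {x₀ x : X} (h₀ : f w₀ = x₀) (β : GenPath x₀ x) :
    ∃ (w : Z) (hw : f w = x) (α : GenPath w₀ w), α.map hf h₀ hw = β := by
  subst h₀
  obtain ⟨⟨w, α⟩, hα⟩ := h w₀ ⟨x, β⟩
  obtain ⟨h1, h2⟩ := Sigma.mk.inj hα
  subst h1
  exact ⟨w, rfl, α, eq_of_heq h2⟩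

end

/-! ### The topology of the uniform fundamental group -/

section

variable {X : Type*} [UniformSpace X] {x₀ : X}

theorem GP.uniformity_hasBasis (x₀ : X) :
    (𝓤 (GP X x₀)).HasBasis (fun _ : Entourage X => True) (GP.star x₀) := by
  refine ⟨fun t => ?_⟩
  refine (FilterBasis.mem_filter_iff _).trans ?_
  constructor
  · rintro ⟨_, ⟨E, rfl⟩, h⟩
    exact ⟨E, trivial, h⟩
  · rintro ⟨E, -, h⟩
    exact ⟨_, ⟨E, rfl⟩, h⟩

theorem UnifPi1.mem_closure_iff {S : Set (UnifPi1 X x₀)} {α : UnifPi1 X x₀} :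
    α ∈ closure S ↔ ∀ E : Entourage X, ∃ β ∈ S, (GenPath.trans (GenPath.reverse α) β).IsShort E := by
  have hb : (𝓤 (UnifPi1 X x₀)).HasBasis (fun _ : Entourage X => True) _ :=
    (GP.uniformity_hasBasis x₀).comap _
  rw [mem_closure_iff_nhds_basis (nhds_basis_uniformity' hb)]
  simp only [forall_const]
  rfl

end

/-! ### Coverings and the images of their fundamental groups -/

namespace GenCovering

variable {X : Type u} [UniformSpace X] (p q : GenCovering X)

theorem uniformContinuous : UniformContinuous p.proj :=
  p.isCovering.generates.uniformContinuous

theorem proj_surjective : Function.Surjective p.proj := by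
  intro x
  have h := p.isCovering.generates.mem_of_mem (i := ⟨Set.univ, Filter.univ_mem, fun _ => trivial⟩)
    trivial
  obtain ⟨⟨a, b⟩, -, e⟩ := refl_mem_uniformity h (x := x)
  exact ⟨a, (Prod.mk.inj e).1⟩

theorem nonempty_genPath (z w : p.space) : Nonempty (GenPath z w) :=
  p.locallyUniformJoinable.nonempty_genPath p.chainConnected z w

variable {p q}

theorem exists_isShort_of_isShort_map (E : Entourage p.space) :
    ∃ F : Entourage X, ∀ {y z : p.space} {y' z' : X} (hy : p.proj y = y') (hz : p.proj z = z')
      (γ : GenPath y z), (γ.map p.uniformContinuous hy hz).IsShort F → γ.IsShort E :=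
  UnifCov.exists_isShort_of_isShort_map p.isCovering.generates p.isCovering.approxUnique
    p.isCovering.chainLifting E

theorem endpoint_eq_of_map_eq {z₀ z z' : p.space} {x₀ x : X} (h₀ : p.proj z₀ = x₀)
    (hz : p.proj z = x) (hz' : p.proj z' = x) {α : GenPath z₀ z} {β : GenPath z₀ z'}
    (h : α.map p.uniformContinuous h₀ hz = β.map p.uniformContinuous h₀ hz') : z = z' :=
  UnifCov.endpoint_eq_of_map_eq p.isCovering.generates p.isCovering.approxUnique
    p.isCovering.chainLifting h₀ hz hz' h

theorem exists_lift {z₀ : p.space} {x₀ x : X} (h₀ : p.proj z₀ = x₀) (β : GenPath x₀ x) :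
    ∃ (z : p.space) (hz : p.proj z = x) (α : GenPath z₀ z),
      α.map p.uniformContinuous h₀ hz = β :=
  p.isCovering.genPathLifting.exists_lift h₀ β

theorem mem_imagePi1 {z₀ : p.space} {x₀ : X} {h : p.proj z₀ = x₀} {β : UnifPi1 X x₀} :
    β ∈ p.imagePi1 h ↔ ∃ η : GenPath z₀ z₀, η.map p.uniformContinuous h h = β :=
  Iff.rfl

/-- Lift a limit $\beta$ to a path $\alpha$ from $z_0$ to $w$. For a loop $\eta$ whose image is
close to $\beta$, the path $\alpha^{-1}\eta$ has short image and is therefore short. So $w$ is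
arbitrarily close to $z_0$, and the lift closes up since the space is Hausdorff. -/
theorem isClosed_imagePi1 {z₀ : p.space} {x₀ : X} (h : p.proj z₀ = x₀) :
    IsClosed (p.imagePi1 h : Set (UnifPi1 X x₀)) := by
  refine isClosed_of_closure_subset fun β hβ => ?_
  rw [UnifPi1.mem_closure_iff] at hβ
  obtain ⟨w, hw, α, hα⟩ := exists_lift h (β : GenPath x₀ x₀)
  have e : w = z₀ := by
    refine Entourage.eq_of_forall_mem fun E => ?_
    obtain ⟨F, hF⟩ := exists_isShort_of_isShort_map E
    obtain ⟨_, hb, hη⟩ := hβ F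
    obtain ⟨η, rfl⟩ := mem_imagePi1.1 hb
    refine (hF hw h (α.reverse.trans η) ?_).1
    rw [GenPath.map_trans _ hw h h, GenPath.map_reverse, hα]
    exact hη
  subst e
  exact ⟨α, hα⟩

theorem inv_mul_mul_mem_imagePi1 {z₀ z₁ : p.space} {x₀ : X} (h₀ : p.proj z₀ = x₀)
    (h₁ : p.proj z₁ = x₀) (α : GenPath z₀ z₁) {g β : UnifPi1 X x₀}
    (hg : α.map p.uniformContinuous h₀ h₁ = g) (hβ : β ∈ p.imagePi1 h₀) :
    g⁻¹ * (β * g) ∈ p.imagePi1 h₁ := by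
  obtain ⟨η, rfl⟩ := mem_imagePi1.1 hβ
  subst hg
  refine mem_imagePi1.2 ⟨α.reverse.trans (η.trans α), ?_⟩
  rw [GenPath.map_trans _ h₁ h₀ h₁, GenPath.map_trans _ h₀ h₀ h₁, GenPath.map_reverse]
  rfl

/-- A change of base points conjugates the image of the fundamental group. -/
theorem imagePi1_eq_map_conj {z₀ z₁ : p.space} {x₀ : X} (h₀ : p.proj z₀ = x₀)
    (h₁ : p.proj z₁ = x₀) (α : GenPath z₀ z₁) {g : UnifPi1 X x₀}
    (hg : α.map p.uniformContinuous h₀ h₁ = g) :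
    p.imagePi1 h₁ = (p.imagePi1 h₀).map (MulAut.conj g⁻¹).toMonoidHom := by
  ext β
  rw [Subgroup.mem_map]
  constructor
  · intro hβ
    refine ⟨g * (β * g⁻¹), ?_, by simp [mul_assoc]⟩
    have hg' : α.reverse.map p.uniformContinuous h₁ h₀ = (g⁻¹ : UnifPi1 X x₀) := by
      rw [GenPath.map_reverse, hg]
      rfl
    simpa using inv_mul_mul_mem_imagePi1 h₁ h₀ α.reverse hg' hβ
  · rintro ⟨b, hb, rfl⟩
    simpa [mul_assoc] using inv_mul_mul_mem_imagePi1 h₀ h₁ α hg hb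

theorem exists_imagePi1_eq_map_conj {z₀ z₁ : p.space} {x₀ : X} (h₀ : p.proj z₀ = x₀)
    (h₁ : p.proj z₁ = x₀) :
    ∃ g : UnifPi1 X x₀, p.imagePi1 h₁ = (p.imagePi1 h₀).map (MulAut.conj g).toMonoidHom := by
  obtain ⟨α⟩ := p.nonempty_genPath z₀ z₁
  exact ⟨_, imagePi1_eq_map_conj h₀ h₁ α rfl⟩

/-- Every conjugate of the image of the fundamental group is the image for some base point. -/
theorem exists_imagePi1_eq_of_conj {z₀ : p.space} {x₀ : X} (h₀ : p.proj z₀ = x₀)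
    (g : UnifPi1 X x₀) : ∃ (z₁ : p.space) (h₁ : p.proj z₁ = x₀),
      p.imagePi1 h₁ = (p.imagePi1 h₀).map (MulAut.conj g).toMonoidHom := by
  obtain ⟨z₁, h₁, α, hα⟩ := exists_lift h₀ (g⁻¹ : UnifPi1 X x₀)
  exact ⟨z₁, h₁, by simpa using imagePi1_eq_map_conj h₀ h₁ α hα⟩

theorem imagePi1_le_of_comp {k : p.space → q.space} (hk : UniformContinuous k)
    (e : p.proj = q.proj ∘ k) {z₀ : p.space} {x₀ : X} (h : p.proj z₀ = x₀)
    (h' : q.proj (k z₀) = x₀) : p.imagePi1 h ≤ q.imagePi1 h' := by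
  rintro _ ⟨η, rfl⟩
  exact ⟨GenPath.map hk rfl rfl η, GenPath.map_comp _ _ _ e _ _ _ _ _ _ _⟩

/-- The lifting criterion: an inclusion of the images of the fundamental groups gives a uniformly
continuous map over the base. -/
theorem exists_map_of_imagePi1_le {z₀ : p.space} {w₀ : q.space} {x₀ : X} (hz₀ : p.proj z₀ = x₀)
    (hw₀ : q.proj w₀ = x₀) (hle : p.imagePi1 hz₀ ≤ q.imagePi1 hw₀) :
    ∃ k : p.space → q.space, UniformContinuous k ∧ p.proj = q.proj ∘ k ∧
      ∀ {z : p.space} {w : q.space} {x : X} (hz : p.proj z = x) (hw : q.proj w = x)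
        (α : GenPath z₀ z) (β : GenPath w₀ w),
        α.map p.uniformContinuous hz₀ hz = β.map q.uniformContinuous hw₀ hw → k z = w := by
  have hα : ∀ z, Nonempty (GenPath z₀ z) := p.nonempty_genPath z₀
  let α : ∀ z, GenPath z₀ z := fun z => (hα z).some
  have hβ : ∀ z, ∃ (w : q.space) (hw : q.proj w = p.proj z) (β : GenPath w₀ w),
      β.map q.uniformContinuous hw₀ hw = (α z).map p.uniformContinuous hz₀ rfl :=
    fun z => exists_lift hw₀ _
  choose k hk β hβ using hβ
  have spec : ∀ {z : p.space} {w : q.space} {x : X} (hz : p.proj z = x) (hw : q.proj w = x)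
      (α : GenPath z₀ z) (β : GenPath w₀ w),
      α.map p.uniformContinuous hz₀ hz = β.map q.uniformContinuous hw₀ hw → k z = w := by
    rintro z w _ rfl hw α' β' h
    -- The endpoint does not depend on the path: the image of $\alpha'\alpha_z^{-1}$ lifts to a loop
    -- $\eta$ at $w_0$, so $\eta\beta_z$ and $\beta'$ lift the same path.
    obtain ⟨η, hη⟩ := mem_imagePi1.1 (hle (mem_imagePi1.2 ⟨α'.trans (α z).reverse, rfl⟩))
    refine endpoint_eq_of_map_eq (α := η.trans (β z)) (β := β') hw₀ (hk z) hw ?_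
    rw [GenPath.map_trans _ hw₀ hw₀ (hk z), hη, hβ z, ← GenPath.map_trans, GenPath.trans_assoc,
      GenPath.reverse_trans_self, GenPath.trans_refl, h]
  refine ⟨k, fun V hV => ?_, funext fun z => (hk z).symm, spec⟩
  obtain ⟨E, hE⟩ := Entourage.exists_subset hV
  obtain ⟨F, hF⟩ := exists_isShort_of_isShort_map (p := q) E
  -- Close points `a`, `b` are joined by a path with `F`-short image. Its lift from `k a` ends at `k
  -- b` by `spec` and is `E`-short.
  obtain ⟨G, -, hG⟩ := p.locallyUniformJoinable (F.preimage p.uniformContinuous)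
  refine Filter.mem_map.2 (Filter.mem_of_superset G.mem_uniformity ?_)
  rintro ⟨a, b⟩ hab
  obtain ⟨γ, hγ⟩ := hG a b hab
  obtain ⟨w, hw, δ, hδ⟩ := exists_lift (p := q) (hk a) (γ.map p.uniformContinuous rfl rfl)
  have e : k b = w := spec rfl hw ((α a).trans γ) ((β a).trans δ) (by
    rw [GenPath.map_trans _ hz₀ rfl rfl, GenPath.map_trans _ hw₀ (hk a) hw, hδ, hβ])
  have hδs : δ.IsShort E := hF (hk a) hw δ (by rw [hδ]; exact hγ.map _ rfl rfl)
  refine hE ?_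
  change (k a, k b) ∈ E.carrier
  rw [e]
  exact hδs.1

/-- Coverings with the same image of the fundamental groups are uniformly equivalent. -/
theorem equivalent_of_imagePi1_eq {z₀ : p.space} {w₀ : q.space} {x₀ : X} (hz₀ : p.proj z₀ = x₀)
    (hw₀ : q.proj w₀ = x₀) (h : p.imagePi1 hz₀ = q.imagePi1 hw₀) :
    equivalence X p q := by
  obtain ⟨k, hk, e, hs⟩ := exists_map_of_imagePi1_le hz₀ hw₀ h.le
  obtain ⟨m, hm, e', hs'⟩ := exists_map_of_imagePi1_le hw₀ hz₀ h.ge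
  refine ⟨⟨⟨k, m, fun z => ?_, fun w => ?_⟩, hk, hm⟩, e⟩
  · obtain ⟨α⟩ := p.nonempty_genPath z₀ z
    obtain ⟨w, hw, β, hβ⟩ := exists_lift hw₀ (α.map p.uniformContinuous hz₀ rfl)
    rw [hs rfl hw α β hβ.symm]
    exact hs' hw rfl β α hβ
  · obtain ⟨α⟩ := q.nonempty_genPath w₀ w
    obtain ⟨z, hz, β, hβ⟩ := exists_lift hz₀ (α.map q.uniformContinuous hw₀ rfl)
    rw [hs' rfl hz α β hβ.symm]
    exact hs hz rfl β α hβ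

theorem imagePi1_eq_of_equiv (k : p.space ≃ᵤ q.space) (e : p.proj = q.proj ∘ k) {z₀ : p.space}
    {x₀ : X} (h : p.proj z₀ = x₀) (h' : q.proj (k z₀) = x₀) : p.imagePi1 h = q.imagePi1 h' := by
  refine le_antisymm (imagePi1_le_of_comp k.uniformContinuous e h h') ?_
  have e' : q.proj = p.proj ∘ k.symm := by
    rw [e]
    ext w
    simp
  have h'' : p.proj (k.symm (k z₀)) = x₀ := by simpa using h
  have := imagePi1_le_of_comp k.symm.uniformContinuous e' h' h''
  simpa only [k.symm_apply_apply] using this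

end GenCovering

/-! ### The covering associated with a closed subgroup -/

/-- A short loop has trivial $E$-term, and conjugation preserves triviality. -/
theorem GenPath.IsShort.conj {X : Type*} [UniformSpace X] {x y : X} {E : Entourage X}
    {γ : GenPath y y} (h : γ.IsShort E) (β : GenPath x y) :
    ((β.trans γ).trans β.reverse).IsShort E := by
  obtain ⟨h1, h2⟩ := h
  refine ⟨E.refl x, ?_⟩
  change ((β.term E).trans (γ.term E)).trans (β.reverse.term E) = _
  rw [h2, ChainClass.trans_edge_self, ChainClass.edge_self]
  exact congrArg (fun α => GenPath.term α E) β.trans_reverse_self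

section

variable {X : Type u} [UniformSpace X] {x₀ : X}

/-- Generalized paths starting at `x₀` are identified if they differ by left translation by an
element of `H`. -/
def orbitSetoid (H : Subgroup (UnifPi1 X x₀)) : Setoid (GP X x₀) where
  r α β := ∃ h ∈ H, β = ⟨α.1, GenPath.trans h α.2⟩
  iseqv :=
    { refl := fun α => ⟨1, H.one_mem, Sigma.ext rfl (heq_of_eq (GenPath.refl_trans _).symm)⟩
      symm := by
        rintro α _ ⟨h, hh, rfl⟩
        refine ⟨h⁻¹, H.inv_mem hh, Sigma.ext rfl (heq_of_eq ?_)⟩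
        exact (GenPath.reverse_trans_cancel _ _).symm
      trans := by
        rintro α _ _ ⟨h, hh, rfl⟩ ⟨k, hk, rfl⟩
        exact ⟨k * h, H.mul_mem hk hh, Sigma.ext rfl (heq_of_eq (GenPath.trans_assoc _ _ _).symm)⟩ }

/-- The quotient of `GP(X, x₀)` by the left translations by elements of `H`. -/
def OrbitSpace (H : Subgroup (UnifPi1 X x₀)) : Type u := Quotient (orbitSetoid H)

namespace OrbitSpace

variable {H : Subgroup (UnifPi1 X x₀)} {x y : X}

/-- The orbit of a generalized path. -/
def mk (H : Subgroup (UnifPi1 X x₀)) (α : GenPath x₀ x) : OrbitSpace H :=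
  Quotient.mk (orbitSetoid H) ⟨x, α⟩

/-- The endpoint projection. -/
def proj : OrbitSpace H → X :=
  Quotient.lift Sigma.fst (by rintro α _ ⟨h, -, rfl⟩; rfl)

theorem proj_mk (α : GenPath x₀ x) : proj (mk H α) = x := rfl

theorem exists_mk {a : OrbitSpace H} (ha : proj a = x) : ∃ α : GenPath x₀ x, mk H α = a := by
  induction a using Quotient.ind with | _ a
  subst ha
  exact ⟨a.2, rfl⟩

theorem exists_rep (a : OrbitSpace H) : ∃ (x : X) (α : GenPath x₀ x), mk H α = a :=
  ⟨proj a, exists_mk rfl⟩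

theorem mk_eq_mk_iff {α β : GenPath x₀ x} :
    mk H α = mk H β ↔ ∃ h ∈ H, β = GenPath.trans h α := by
  refine Quotient.eq.trans ⟨?_, ?_⟩
  · rintro ⟨h, hh, e⟩
    exact ⟨h, hh, eq_of_heq (Sigma.mk.inj e).2⟩
  · rintro ⟨h, hh, rfl⟩
    exact ⟨h, hh, rfl⟩

/-- The pairs of orbits of generalized paths that differ by an `E`-short one. -/
def star (H : Subgroup (UnifPi1 X x₀)) (E : Entourage X) : Set (OrbitSpace H × OrbitSpace H) :=
  {p | ∃ (x y : X) (α : GenPath x₀ x) (γ : GenPath x y), γ.IsShort E ∧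
    p = (mk H α, mk H (α.trans γ))}

theorem mk_mem_star {E : Entourage X} (α : GenPath x₀ x) {γ : GenPath x y} (h : γ.IsShort E) :
    (mk H α, mk H (α.trans γ)) ∈ star H E :=
  ⟨x, y, α, γ, h, rfl⟩

/-- The representative of the first orbit can be prescribed, since left translation by $H$ commutes
with concatenation on the right. -/
theorem exists_of_mem_star {E : Entourage X} {α : GenPath x₀ x} {b : OrbitSpace H}
    (h : (mk H α, b) ∈ star H E) (hb : proj b = y) :
    ∃ γ : GenPath x y, γ.IsShort E ∧ b = mk H (α.trans γ) := by
  obtain ⟨x', y', α', γ, hγ, e⟩ := h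
  obtain ⟨e1, rfl⟩ := Prod.mk.inj e
  obtain rfl : x' = x := (congrArg proj e1).symm
  obtain rfl : y' = y := hb
  obtain ⟨k, hk, e2⟩ := mk_eq_mk_iff.1 e1.symm
  subst e2
  exact ⟨γ, hγ, mk_eq_mk_iff.2 ⟨k, hk, GenPath.trans_assoc _ _ _⟩⟩

theorem exists_endpoint_of_mem_star {E : Entourage X} {α : GenPath x₀ x} {b : OrbitSpace H}
    (h : (mk H α, b) ∈ star H E) :
    ∃ (y : X) (γ : GenPath x y), γ.IsShort E ∧ b = mk H (α.trans γ) :=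
  ⟨_, exists_of_mem_star h rfl⟩

theorem mem_of_mem_star {E : Entourage X} {a b : OrbitSpace H} (h : (a, b) ∈ star H E) :
    (proj a, proj b) ∈ E.carrier := by
  obtain ⟨x, y, α, γ, hγ, e⟩ := h
  obtain ⟨rfl, rfl⟩ := Prod.mk.inj e
  exact hγ.1

theorem star_symm {E : Entourage X} {a b : OrbitSpace H} (h : (a, b) ∈ star H E) :
    (b, a) ∈ star H E := by
  obtain ⟨x, y, α, γ, hγ, e⟩ := h
  obtain ⟨rfl, rfl⟩ := Prod.mk.inj e
  have := mk_mem_star (H := H) (α.trans γ) hγ.reverse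
  rwa [GenPath.trans_assoc, GenPath.trans_reverse_self, GenPath.trans_refl] at this

/-- The uniform structure on the orbit space induced by that of `GP(X, x₀)`. -/
instance : UniformSpace (OrbitSpace H) :=
  UniformSpace.ofCore <| UniformSpace.Core.mkOfBasis
    { sets := Set.range (star H)
      nonempty := ⟨_, ⟨⟨Set.univ, Filter.univ_mem, fun _ => trivial⟩, rfl⟩⟩
      inter_sets := by
        rintro _ _ ⟨E, rfl⟩ ⟨F, rfl⟩
        refine ⟨_, ⟨E.inter F, rfl⟩, ?_⟩
        rintro _ ⟨x, y, α, γ, hγ, rfl⟩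
        exact ⟨mk_mem_star α (hγ.mono Set.inter_subset_left),
          mk_mem_star α (hγ.mono Set.inter_subset_right)⟩ }
    (by
      rintro _ ⟨E, rfl⟩ a
      obtain ⟨x, α, rfl⟩ := exists_rep a
      have := mk_mem_star (H := H) α (GenPath.isShort_refl E x)
      rwa [GenPath.trans_refl] at this)
    (by
      rintro _ ⟨E, rfl⟩
      exact ⟨_, ⟨E, rfl⟩, fun p hp => star_symm hp⟩)
    (by
      rintro _ ⟨E, rfl⟩
      obtain ⟨F, hFE, hF⟩ := E.exists_comp
      refine ⟨_, ⟨F, rfl⟩, ?_⟩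
      rintro ⟨a, c⟩ ⟨b, h1, h2⟩
      obtain ⟨x, α, rfl⟩ := exists_rep a
      obtain ⟨y, γ, hγ, rfl⟩ := exists_endpoint_of_mem_star h1
      obtain ⟨z, δ, hδ, rfl⟩ := exists_endpoint_of_mem_star h2
      rw [GenPath.trans_assoc]
      exact mk_mem_star α (hγ.trans hFE hF hδ))

theorem mem_uniformity_iff {V : Set (OrbitSpace H × OrbitSpace H)} :
    V ∈ 𝓤 (OrbitSpace H) ↔ ∃ E : Entourage X, star H E ⊆ V := by
  refine (FilterBasis.mem_filter_iff _).trans ?_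
  constructor
  · rintro ⟨_, ⟨E, rfl⟩, h⟩
    exact ⟨E, h⟩
  · rintro ⟨E, h⟩
    exact ⟨_, ⟨E, rfl⟩, h⟩

/-- The basic entourages of the orbit space. -/
def starEntourage (H : Subgroup (UnifPi1 X x₀)) (E : Entourage X) : Entourage (OrbitSpace H) where
  carrier := star H E
  mem_uniformity := mem_uniformity_iff.2 ⟨E, subset_rfl⟩
  symm := star_symm

/-- Inseparable orbits of $\alpha$ and $\beta$ have the same endpoint, and $\beta\alpha^{-1}$ is a
limit of elements of $H$. Closedness puts it in $H$, so the orbits agree. -/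
theorem t2Space [T2Space X] (hH : IsClosed (H : Set (UnifPi1 X x₀))) : T2Space (OrbitSpace H) := by
  have : T0Space (OrbitSpace H) := by
    rw [t0Space_iff_uniformity]
    intro a b h
    have h' : ∀ E : Entourage X, (a, b) ∈ star H E := fun E =>
      h _ (starEntourage H E).mem_uniformity
    have e : proj a = proj b := Entourage.eq_of_forall_mem fun E => mem_of_mem_star (h' E)
    obtain ⟨x, β, rfl⟩ := exists_rep b
    obtain ⟨α, rfl⟩ := exists_mk (x := x) e
    let η : UnifPi1 X x₀ := β.trans α.reverse
    have hη : η ∈ closure (H : Set (UnifPi1 X x₀)) := by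
      refine UnifPi1.mem_closure_iff.2 fun E => ?_
      -- Here $\gamma$ is a short loop with $\beta\gamma=k\alpha$ and $k\in H$. Then
      -- $\eta^{-1}k=\alpha\gamma\alpha^{-1}$ is short, so $k$ approximates $\eta$.
      obtain ⟨γ, hγ, e'⟩ := exists_of_mem_star (y := x) (star_symm (h' E)) rfl
      obtain ⟨k, hk, e''⟩ := mk_eq_mk_iff.1 e'
      have e3 : k = (β.trans γ).trans α.reverse := by
        rw [e'']
        exact ((GenPath.trans_assoc _ _ _).trans
          ((congrArg _ α.trans_reverse_self).trans (GenPath.trans_refl _))).symm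
      have hs : ((β.trans α.reverse).reverse.trans ((β.trans γ).trans α.reverse)).IsShort E := by
        rw [GenPath.reverse_trans, GenPath.reverse_reverse, GenPath.trans_assoc,
          GenPath.trans_assoc β, GenPath.reverse_trans_cancel, ← GenPath.trans_assoc]
        exact hγ.conj α
      subst e3
      exact ⟨_, hk, hs⟩
    rw [hH.closure_eq] at hη
    refine mk_eq_mk_iff.2 ⟨η, hη, ?_⟩
    exact ((GenPath.trans_assoc _ _ _).trans
      ((congrArg _ α.reverse_trans_self).trans (GenPath.trans_refl _))).symm
  infer_instance

/-- A chain lifts, together with a generalized path approximating it, if its consecutive points are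
joined by short generalized paths. -/
theorem exists_chain_lift {E F : Entourage X} (hFE : F.carrier ⊆ E.carrier)
    (hF : ∀ x y : X, (x, y) ∈ F.carrier → ∃ α : GenPath x y, α.IsShort E)
    (hFi : F.carrier ⊆ (starEntourage H E).image proj) (x : X) (a : ChainClass F.carrier x y) :
    ∀ α : GenPath x₀ x, ∃ γ : GenPath x y, γ.term E = a.ofSubset hFE ∧
      ∀ b : OrbitSpace H, b = mk H (α.trans γ) → ∀ hb : proj b = y,
        ∃ c : ChainClass (starEntourage H E).carrier (mk H α) b,
          c.map proj (fun _ hp => Entourage.mem_image _ hp) rfl hb = a.ofSubset hFi := by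
  induction x, a using ChainClass.edge_induction with
  | refl =>
    intro α
    refine ⟨GenPath.refl y, rfl, fun b hb hb' => ?_⟩
    rw [GenPath.trans_refl] at hb
    subst hb
    exact ⟨ChainClass.mk (EChain.refl _ _), rfl⟩
  | edge x z h a ih =>
    intro α
    obtain ⟨γ, hγ⟩ := hF x z h
    obtain ⟨γ', h1, h2⟩ := ih (α.trans γ)
    refine ⟨γ.trans γ', ?_, fun b hb hb' => ?_⟩
    · obtain ⟨h3, h4⟩ := hγ
      rw [ChainClass.ofSubset_trans, ← h1]
      change (γ.term E).trans _ = _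
      rw [h4]
      rfl
    · obtain ⟨c, hc⟩ := h2 b (by rw [hb, GenPath.trans_assoc]) hb'
      refine ⟨(ChainClass.mk (EChain.edge (mk_mem_star α hγ))).trans c, ?_⟩
      rw [ChainClass.ofSubset_trans, ← hc]
      exact ChainClass.map_trans _ _ _ _ _ _ _

/-! ### The endpoint projection as a generalized uniform covering map -/

theorem starEntourage_subset {E : Entourage (OrbitSpace H)} {E₀ : Entourage X}
    (h : star H E₀ ⊆ E.carrier) :
    (starEntourage H E₀).image proj ⊆ E.image (proj (H := H)) :=
  Entourage.image_mono proj h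

theorem subset_image_star {E F : Entourage X} (hX : LocallyUniformJoinable X)
    (hc : ChainConnected X)
    (hF : ∀ x y : X, (x, y) ∈ F.carrier → ∃ α : GenPath x y, α.IsShort E) :
    F.carrier ⊆ (starEntourage H E).image proj := by
  rintro ⟨x, y⟩ h
  obtain ⟨γ, hγ⟩ := hF x y h
  obtain ⟨α⟩ := hX.nonempty_genPath hc x₀ x
  exact ⟨_, mk_mem_star α hγ, rfl⟩

theorem generatesUniformity_proj (hX : LocallyUniformJoinable X) (hc : ChainConnected X) :
    GeneratesUniformity (proj (H := H)) := by
  refine ⟨fun V => ⟨fun hV => ?_, ?_⟩⟩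
  · obtain ⟨E, hE⟩ := Entourage.exists_subset hV
    refine ⟨starEntourage H E, trivial, ?_⟩
    rintro _ ⟨p, hp, rfl⟩
    exact hE (mem_of_mem_star hp)
  · rintro ⟨E, -, hE⟩
    obtain ⟨E₀, hE₀⟩ := mem_uniformity_iff.1 E.mem_uniformity
    obtain ⟨F, -, hF⟩ := hX E₀
    exact Filter.mem_of_superset F.mem_uniformity
      (((subset_image_star hX hc hF).trans (starEntourage_subset hE₀)).trans hE)

/-- Each edge of the chain below is realized by a short generalized path, and appending it to the
current representative gives the next point. -/
theorem chainLifting_proj (hX : LocallyUniformJoinable X) :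
    ChainLifting (proj (H := H)) := by
  intro E
  obtain ⟨E₀, hE₀⟩ := mem_uniformity_iff.1 E.mem_uniformity
  obtain ⟨F, -, hF⟩ := hX E₀
  refine ⟨starEntourage H F, fun a l hl => ?_⟩
  induction l generalizing a with
  | nil => exact ⟨[], by simp [IsEChain], rfl⟩
  | cons y l ih =>
    obtain ⟨h1, h2⟩ := List.isChain_cons_cons.1 hl
    obtain ⟨x, α, rfl⟩ := exists_rep a
    have h3 : (x, y) ∈ F.carrier := by
      obtain ⟨p, hp, e⟩ := h1
      have := mem_of_mem_star hp
      exact e ▸ this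
    obtain ⟨γ, hγ⟩ := hF x y h3
    obtain ⟨l', h4, h5⟩ := ih (mk H (α.trans γ)) h2
    exact ⟨mk H (α.trans γ) :: l',
      List.isChain_cons_cons.2 ⟨hE₀ (mk_mem_star α hγ), h4⟩, by rw [List.map_cons, h5]; rfl⟩

/-- Corresponding points of two lifts differ by a short loop. Its $E_0$-term is trivial, and passing
along the next edges keeps it trivial, so errors do not accumulate and a basic entourage inside $E$
suffices. -/
theorem approxUnique_proj : ApproxUniqueChainLifts (proj (H := H)) := by
  intro E
  obtain ⟨E₀, hE₀⟩ := mem_uniformity_iff.1 E.mem_uniformity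
  refine ⟨starEntourage H E₀, hE₀, fun a l l' h h' e => ?_⟩
  have key : ∀ (l l' : List (OrbitSpace H)) (x : X) (α : GenPath x₀ x) (ε : GenPath x x),
      ε.IsShort E₀ → IsEChain (star H E₀) (mk H α :: l) →
      IsEChain (star H E₀) (mk H (α.trans ε) :: l') → l.map proj = l'.map proj →
      List.Forall₂ (fun a b => (a, b) ∈ E.carrier) l l' := by
    intro l
    induction l with
    | nil =>
      intro l' _ _ _ _ _ _ e
      obtain rfl : l' = [] := by simpa using e.symm
      exact List.Forall₂.nil
    | cons b l ih =>
      intro l' x α ε hε h h' e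
      rw [List.map_cons] at e
      obtain ⟨b', l', rfl, e1, e2⟩ := List.map_eq_cons_iff.1 e.symm
      obtain ⟨h1, h2⟩ := List.isChain_cons_cons.1 h
      obtain ⟨h1', h2'⟩ := List.isChain_cons_cons.1 h'
      obtain ⟨γ, hγ, e3⟩ := exists_of_mem_star h1 rfl
      obtain ⟨γ', hγ', e4⟩ := exists_of_mem_star h1' e1
      generalize proj b = y at γ γ'
      subst e3 e4
      -- The new discrepancy $\gamma^{-1}\varepsilon\gamma'$ runs back along an edge, stays, and
      -- returns along the same edge at scale `E₀`.
      have hs : ((γ.reverse.trans ε).trans γ').IsShort E₀ :=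
        (hγ.reverse.trans_of_mem hε hγ.reverse.1).trans_of_mem hγ' (E₀.refl _)
      have e5 : (α.trans ε).trans γ' =
          (α.trans γ).trans ((γ.reverse.trans ε).trans γ') := by
        simp only [GenPath.trans_assoc, GenPath.trans_reverse_cancel]
      rw [e5] at h2' ⊢
      exact List.Forall₂.cons (hE₀ (mk_mem_star _ hs)) (ih _ _ _ _ hs h2 h2' e2.symm)
  obtain ⟨x, α, rfl⟩ := exists_rep a
  exact key l l' x α _ (GenPath.isShort_refl E₀ x) h (by rwa [GenPath.trans_refl]) e

/-- Every generalized path `β` lifts to one from the orbit of `α` to the orbit of `αβ`. -/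
theorem exists_genPath_lift (hX : LocallyUniformJoinable X) (hc : ChainConnected X)
    (α : GenPath x₀ x) (β : GenPath x y) {b : OrbitSpace H} (hb : b = mk H (α.trans β))
    (hy : proj b = y) :
    ∃ δ : GenPath (mk H α) b,
      δ.map (generatesUniformity_proj hX hc).uniformContinuous rfl hy = β := by
  subst hb
  refine UnifCov.exists_genPath_lift (z := mk H α) (w := mk H (α.trans β))
    (generatesUniformity_proj hX hc) approxUnique_proj (chainLifting_proj hX) β fun E => ?_
  obtain ⟨E₀, hE₀⟩ := mem_uniformity_iff.1 E.mem_uniformity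
  obtain ⟨F, hFE, hF⟩ := hX E₀
  have hFi := subset_image_star (H := H) hX hc hF
  -- The lifted chain ends at the orbit of $\alpha\gamma$, where $\gamma$ has only the same
  -- `E₀`-term as $\beta$. So $\gamma^{-1}\beta$ is a short loop, giving an edge to the orbit of
  -- $\alpha\beta$ that projects to the trivial edge at $y$.
  obtain ⟨γ, h1, h2⟩ := exists_chain_lift hFE hF hFi x (β.term F) α
  obtain ⟨c, h3⟩ := h2 _ rfl rfl
  have hs : (γ.reverse.trans β).IsShort E₀ := by
    refine ⟨E₀.refl y, ?_⟩
    rw [ChainClass.edge_self, ← ChainClass.reverse_trans_self E₀.symm E₀.refl (γ.term E₀)]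
    rw [β.compat] at h1
    change _ = (γ.reverse.term E₀).trans _
    rw [h1]
    rfl
  have hm := mk_mem_star (H := H) (α.trans γ) hs
  rw [GenPath.trans_assoc, GenPath.trans_reverse_cancel] at hm
  refine ⟨(c.ofSubset hE₀).trans (ChainClass.mk (EChain.edge (hE₀ hm))), ?_⟩
  have e1 : (ChainClass.mk (EChain.edge (hE₀ hm))).map (F := E.image proj) proj
      (fun _ hp => E.mem_image hp) (rfl : proj (mk H (α.trans γ)) = y)
      (rfl : proj (mk H (α.trans β)) = y) =
      ChainClass.mk (EChain.edge (E.mem_image (hE₀ hm))) := rfl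
  rw [ChainClass.map_trans proj _ rfl (rfl : proj (mk H (α.trans γ)) = y) rfl, e1]
  have e2 : (c.ofSubset hE₀).map (F := E.image proj) proj (fun _ hp => E.mem_image hp)
      (rfl : proj (mk H α) = x) (rfl : proj (mk H (α.trans γ)) = y) =
      β.term (E.imageOf (generatesUniformity_proj hX hc)) := by
    have := congrArg (fun a => a.ofSubset (starEntourage_subset hE₀)) h3
    refine Eq.trans ?_ (this.trans ((ChainClass.ofSubset_ofSubset _ _ _).trans
      (β.compat (E.imageOf (generatesUniformity_proj hX hc)) F
        (hFi.trans (starEntourage_subset hE₀)))))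
    induction c using ChainClass.ind with | _ c
    change ChainClass.mk _ = ChainClass.mk _
    congr 1
    ext1
    simp [EChain.map]
  rw [e2]
  exact ChainClass.trans_edge_self _ _

theorem isGenUniformCovering_proj (hX : LocallyUniformJoinable X) (hc : ChainConnected X) :
    IsGenUniformCovering (proj (H := H)) where
  generates := generatesUniformity_proj hX hc
  chainLifting := chainLifting_proj hX
  approxUnique := approxUnique_proj
  genPathLifting := by
    rintro a ⟨y, β⟩
    obtain ⟨x, α, rfl⟩ := exists_rep a
    obtain ⟨δ, hδ⟩ := exists_genPath_lift (H := H) hX hc α β rfl rfl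
    exact ⟨⟨_, δ⟩, Sigma.ext rfl (heq_of_eq hδ)⟩

/-- The short path that makes two orbits close lifts to a path between them, and a lift of a
sufficiently short path is short. -/
theorem locallyUniformJoinable (hX : LocallyUniformJoinable X) (hc : ChainConnected X) :
    LocallyUniformJoinable (OrbitSpace H) := by
  intro E
  obtain ⟨F, hF⟩ := exists_isShort_of_isShort_map (generatesUniformity_proj (H := H) hX hc)
    approxUnique_proj (chainLifting_proj hX) E
  have hs : ∀ a b : OrbitSpace H, (a, b) ∈ star H F → ∃ δ : GenPath a b, δ.IsShort E := by
    intro a b h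
    obtain ⟨x, α, rfl⟩ := exists_rep a
    obtain ⟨y, γ, hγ, rfl⟩ := exists_endpoint_of_mem_star h
    obtain ⟨δ, hδ⟩ := exists_genPath_lift (H := H) hX hc α γ rfl rfl
    rw [← hδ] at hγ
    exact ⟨δ, hF _ _ δ hγ⟩
  refine ⟨(starEntourage H F).inter E, Set.inter_subset_right, fun a b h => hs a b h.1⟩

theorem chainConnected (hX : LocallyUniformJoinable X) (hc : ChainConnected X) :
    ChainConnected (OrbitSpace H) := by
  intro E a b
  obtain ⟨x, α, rfl⟩ := exists_rep a
  obtain ⟨y, β, rfl⟩ := exists_rep b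
  obtain ⟨δ, -⟩ := exists_genPath_lift (H := H) hX hc α (α.reverse.trans β)
    (by rw [GenPath.trans_reverse_cancel]) (proj_mk β)
  induction δ.term E using ChainClass.ind with | _ c => exact ⟨c⟩

end OrbitSpace

/-- The covering whose fundamental group has image `H`. -/
def ClosedSubgroup.covering [T2Space X] (hX : LocallyUniformJoinable X) (hc : ChainConnected X)
    (H : ClosedSubgroup X x₀) : GenCovering X where
  space := OrbitSpace H.1
  t2 := OrbitSpace.t2Space H.2
  locallyUniformJoinable := OrbitSpace.locallyUniformJoinable hX hc
  chainConnected := OrbitSpace.chainConnected hX hc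
  proj := OrbitSpace.proj
  isCovering := OrbitSpace.isGenUniformCovering_proj hX hc

/-- The base point is the orbit of the constant path. Since $\beta$ lifts to a path ending at its
own orbit and endpoints of lifts are unique, it lifts to a loop exactly when its orbit is the base
point. -/
theorem ClosedSubgroup.exists_imagePi1_covering [T2Space X] (hX : LocallyUniformJoinable X)
    (hc : ChainConnected X) (H : ClosedSubgroup X x₀) :
    ∃ (z₀ : (H.covering hX hc).space) (h : (H.covering hX hc).proj z₀ = x₀),
      (H.covering hX hc).imagePi1 h = H.1 := by
  let z₀ : (H.covering hX hc).space := OrbitSpace.mk H.1 (GenPath.refl x₀)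
  have h₀ : (H.covering hX hc).proj z₀ = x₀ := rfl
  refine ⟨z₀, h₀, ?_⟩
  have lift : ∀ (β : GenPath x₀ x₀) (b : (H.covering hX hc).space)
      (hb : b = OrbitSpace.mk H.1 β) (hy : (H.covering hX hc).proj b = x₀),
      ∃ δ : GenPath z₀ b, δ.map (H.covering hX hc).uniformContinuous h₀ hy = β := by
    intro β b hb hy
    rw [← GenPath.refl_trans β] at hb
    exact OrbitSpace.exists_genPath_lift hX hc (GenPath.refl x₀) β hb hy
  ext β
  rw [GenCovering.mem_imagePi1]
  constructor
  · rintro ⟨η, hη⟩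
    obtain ⟨δ, hδ⟩ := lift β _ rfl rfl
    have e := GenCovering.endpoint_eq_of_map_eq h₀ h₀ _ (hη.trans hδ.symm)
    obtain ⟨k, hk, e'⟩ := OrbitSpace.mk_eq_mk_iff.1 e
    have : β = k := e'.trans (GenPath.trans_refl _)
    rwa [this]
  · intro hβ
    exact lift β z₀ (OrbitSpace.mk_eq_mk_iff.2 ⟨β, hβ, (GenPath.trans_refl _).symm⟩) h₀

end

end UnifCov

/-! ### The classification -/

theorem mainTheorem1 {X : Type u} [UniformSpace X] [T2Space X]
    (hX : UnifCov.LocallyUniformJoinable X) (hc : UnifCov.ChainConnected X) (x₀ : X) :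
    ∃ Φ : Quotient (UnifCov.GenCovering.equivalence X) ≃
        Quotient (UnifCov.ClosedSubgroup.conjugacy X x₀),
      ∀ (p : UnifCov.GenCovering X) (z₀ : p.space) (h : p.proj z₀ = x₀),
        ∃ hcl : IsClosed (p.imagePi1 h : Set (UnifCov.UnifPi1 X x₀)),
          Φ (Quotient.mk _ p) = Quotient.mk _ ⟨p.imagePi1 h, hcl⟩ := by
  choose z hz using fun p : UnifCov.GenCovering X => p.proj_surjective x₀
  let Ψ : UnifCov.GenCovering X → UnifCov.ClosedSubgroup X x₀ := fun p =>
    ⟨p.imagePi1 (hz p), UnifCov.GenCovering.isClosed_imagePi1 (hz p)⟩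
  have hΨ : ∀ p q : UnifCov.GenCovering X, UnifCov.GenCovering.equivalence X p q →
      UnifCov.ClosedSubgroup.conjugacy X x₀ (Ψ p) (Ψ q) := by
    rintro p q ⟨k, e⟩
    have h : q.proj (k (z p)) = x₀ := by rw [← hz p, e]; rfl
    obtain ⟨g, hg⟩ := UnifCov.GenCovering.exists_imagePi1_eq_map_conj h (hz q)
    refine ⟨g, hg.trans ?_⟩
    rw [← UnifCov.GenCovering.imagePi1_eq_of_equiv k e (hz p) h]
  refine ⟨Equiv.ofBijective (Quotient.map Ψ hΨ) ⟨?_, ?_⟩, fun p z₀ h =>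
    ⟨UnifCov.GenCovering.isClosed_imagePi1 h, Quotient.sound ?_⟩⟩
  · intro a b
    induction a, b using Quotient.inductionOn₂ with | _ p q
    intro hab
    obtain ⟨g, hg⟩ := Quotient.exact hab
    -- Moving the base point of `p` within its fibre turns conjugate images into equal ones.
    obtain ⟨z₁, h₁, e⟩ := UnifCov.GenCovering.exists_imagePi1_eq_of_conj (hz p) g
    exact Quotient.sound (UnifCov.GenCovering.equivalent_of_imagePi1_eq h₁ (hz q)
      (e.trans hg.symm))
  · intro H
    induction H using Quotient.inductionOn with | _ H
    obtain ⟨z₀, h, e⟩ := H.exists_imagePi1_covering hX hc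
    obtain ⟨g, hg⟩ := UnifCov.GenCovering.exists_imagePi1_eq_map_conj (hz _) h
    exact ⟨Quotient.mk _ (H.covering hX hc), Quotient.sound ⟨g, by rw [← e, hg]⟩⟩
  · exact UnifCov.GenCovering.exists_imagePi1_eq_map_conj (hz p) h
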